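/- Let $\mathbb K=\mathbb R$ or $\mathbb C$ and $d\ge 0$. For an open set $U\subseteq\mathbb R^d$ write $C^\infty(U)$ for the smooth $\mathbb K$-valued functions on $U$, $\partial_i=\partial/\partial x^i$, and use the summation convention. Let $\theta=\frac12\,\theta^{ij}\,\partial_i\wedge\partial_j$ be an almost Poisson structure (a bivector) on $U$, with Jacobiator components $\Pi^{ijk}=\frac13(\theta^{il}\partial_l\theta^{jk}+\theta^{kl}\partial_l\theta^{ij}+\theta^{jl}\partial_l\theta^{ki})$. A local symplectic embedding of $(U,\theta)$ consists of functions $\theta^{ij|k_1\cdots k_n}$ ($n\ge0$) and $\gamma_i^{j|k_1\cdots k_n}$ ($n\ge1$) in $C^\infty(U)$, symmetric in the $k$'s and with $\theta^{ij|\cdots}$ skew in $ij$, equal to $\theta^{ij}$ for $n=0$ and to $-\Pi^{ijk_1}$ for $n=1$ in the case of $\theta^{ij|\cdots}$, such that with $$\underline\theta^{ij}(x,p)=\sum_{n\ge0}t^n\,\theta^{ij|k_1\cdots k_n}(x)\,p_{k_1}\cdots p_{k_n},\qquad \gamma_i^j(x,p)=\sum_{n\ge1}t^{n-1}\,\gamma_i^{j|k_1\cdots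 k_n}(x)\,p_{k_1}\cdots p_{k_n}$$ the bracket defined by $\{x^i,x^j\}=t\,\underline\theta^{ij}$, $\{x^i,p_j\}=\delta^i_j+t\,\gamma^i_j$, $\{p_i,p_j\}=0$ satisfies the Jacobi identity on $C^\infty(U)[p_1,\dots,p_d][[t]]$. Write $\underline\theta^{ij}(A)$, $\gamma_i^j(A)$ for these series with $p$ replaced by $A=(A_1,\dots,A_d)$, and $\partial_A^i=\partial/\partial A_i$ (with $\partial_l$ taken at fixed $A$). Consider for $\Lambda^{ij}\in C^\infty(U)[A_1,\dots,A_d][[t]]$ the equation determining the derivative-independent part of the Lagrangian multipliers, for all $i,j,k$: $$\begin{aligned} & t(\partial_A^i\Lambda^{kj}-\partial_A^j\Lambda^{ki})+t^3(\Lambda^{lj}\partial_l\Lambda^{ki}-\Lambda^{li}\partial_l\Lambda^{kj})\\ &\quad=-\partial_A^k\underline\theta^{ij}+t^2\big(\Lambda^{kl}\partial_l\underline\theta^{ij}+\Lambda^{li}\partial_A^k\gamma_l^j-\Lambda^{lj}\partial_A^k\gamma_l^i+\underline\theta^{jl}\partial_l\Lambda^{ki}-\underline\theta^{il}\partial_l\Lambda^{kj}+\gamma_l^j\partial_A^l\Lambda^{ki}-\gamma_l^i\partial_A^l\Lambda^{kj}\big)\\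 &\qquad+t^4\big(\gamma_m^l\Lambda^{mi}\partial_l\Lambda^{kj}-\gamma_m^l\Lambda^{mj}\partial_l\Lambda^{ki}\big)+t^4\,\Lambda^{km}\big(\Lambda^{lj}\partial_m\gamma_l^i-\Lambda^{li}\partial_m\gamma_l^j\big). \end{aligned}\tag{$*$}$$ Then for every $U$, every $\theta$ and every local symplectic embedding of $(U,\theta)$ there is exactly one family of functions $\Upsilon^{ijl|k_1\cdots k_n}\in C^\infty(U)$, $n\ge1$, symmetric in $k_1,\dots,k_n$, skew-symmetric in $jl$, such that, with $\Upsilon^{ijl}_{(n)}:=\Upsilon^{ijl|k_1\cdots k_n}A_{k_1}\cdots A_{k_n}$, the integrability conditions $\partial_A^m\Upsilon^{ijl}_{(n)}+\partial_A^j\Upsilon^{ilm}_{(n)}+\partial_A^l\Upsilon^{imj}_{(n)}=0$ hold for all $n\ge1$ and the formal power series $$\Lambda^{ij}(A)=-\tfrac12\,\Pi^{ijk}A_k-\sum_{n=1}^\infty\frac{t^n}{n+2}\,\Upsilon^{ijl|k_1\cdots k_n}\,A_l\,A_{k_1}\cdots A_{k_n}$$ solves $(*)$. Moreover, for each $n\ge1$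 the coefficient $\Lambda^{ij}_{n+1}$ of $t^n$ in $\Lambda^{ij}$ satisfies $\partial_A^i\Lambda^{kj}_{n+1}-\partial_A^j\Lambda^{ki}_{n+1}=\Upsilon^{kij}_{(n)}$. The $\Upsilon^{ijl|k_1\cdots k_n}$ are given by explicit universal expressions: they are polynomials with rational coefficients, depending only on $d$, $n$ and the indices (and not on $U$, $\theta$ or the embedding), in the coefficient functions $\theta^{ij}$, $\Pi^{ijk}$, $\theta^{ij|k_1\cdots k_m}$, $\gamma_i^{j|k_1\cdots k_m}$ of the embedding and their partial derivatives. In particular, on the embeddings whose coefficient functions are given by fixed universal polynomials with rational coefficients in the $\theta^{ij}$ and their partial derivatives, the $\Upsilon^{ijl|k_1\cdots k_n}$ are universal polynomials with rational coefficients in the $\theta^{ij}$ and their partial derivatives. -/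

import Mathlib

open scoped ContDiff BigOperators

noncomputable section

namespace AlmostPoisson

/-! ### Smooth functions on an open subset of `ℝ^d` and their partial derivatives -/

section Smooth

variable {𝕜 : Type*} [RCLike 𝕜] {d : ℕ} {U : TopologicalSpace.Opens (Fin d → ℝ)}

/-- Extension by zero of a function on `U` (only its values on `U` are ever used). -/
def zeroExt (f : U → 𝕜) : (Fin d → ℝ) → 𝕜 := Function.extend Subtype.val f 0

theorem zeroExt_apply (f : U → 𝕜) {x : Fin d → ℝ} (hx : x ∈ U) :
    zeroExt f x = f ⟨x, hx⟩ :=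
  Subtype.val_injective.extend_apply f 0 ⟨x, hx⟩

variable (𝕜 U) in
/-- The algebra `C^∞(U)` of `𝕜`-valued smooth functions on the open set `U ⊆ ℝ^d`,
where `𝕜` is `ℝ` or `ℂ`. -/
def smoothFun : Subalgebra 𝕜 (U → 𝕜) where
  carrier := {f | ContDiffOn ℝ ∞ (zeroExt f) U}
  mul_mem' := by
    intro f g hf hg
    refine (ContDiffOn.mul hf hg).congr fun x hx => ?_
    simp [zeroExt_apply _ (show x ∈ U from hx)]
  add_mem' := by
    intro f g hf hg
    refine (ContDiffOn.add hf hg).congr fun x hx => ?_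
    simp [zeroExt_apply _ (show x ∈ U from hx)]
  algebraMap_mem' := by
    intro r
    refine (contDiffOn_const (c := r)).congr fun x hx => ?_
    simp [zeroExt_apply _ (show x ∈ U from hx)]

variable (𝕜 U) in
/-- `C^∞(U)` as a type. -/
abbrev SmoothFun := ↥(smoothFun 𝕜 U)

/-- The partial derivative `∂_i = ∂/∂x^i` on `C^∞(U)`. -/
def pd (i : Fin d) (f : SmoothFun 𝕜 U) : SmoothFun 𝕜 U :=
  ⟨fun x => fderiv ℝ (zeroExt f.1) x.1 (Pi.single i 1), by
    have h : ContDiffOn ℝ ∞ (fun x => fderiv ℝ (zeroExt f.1) x (Pi.single i 1)) U :=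
      (ContDiffOn.fderiv_of_isOpen f.2 U.isOpen (by simp)).clm_apply contDiffOn_const
    refine h.congr fun x hx => ?_
    exact zeroExt_apply _ hx⟩

end Smooth

/-! ### Formal power series of functions on `T^*U` that are polynomial on the fibres -/

section Fibre

variable (𝕜 : Type*) [RCLike 𝕜] {d : ℕ} (U : TopologicalSpace.Opens (Fin d → ℝ))

/-- Smooth functions on `T^*U = U × ℝ^d` that are polynomial in the fibre coordinates
`p_1, …, p_d` (also written `A_1, …, A_d` after pulling back along a section). -/
abbrev FibrePoly := MvPolynomial (Fin d) (SmoothFun 𝕜 U)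

/-- Formal power series in `t` of such functions; `t` is `PowerSeries.X`. -/
abbrev FormalFun := PowerSeries (FibrePoly 𝕜 U)

variable {𝕜 U}

/-- `∂/∂x^l` on `FormalFun`, at fixed fibre coordinates. -/
def dBase (l : Fin d) (F : FormalFun 𝕜 U) : FormalFun 𝕜 U :=
  PowerSeries.mk fun n => ∑ m ∈ (PowerSeries.coeff n F).support,
    MvPolynomial.monomial m (pd l ((PowerSeries.coeff n F).coeff m))

/-- `∂/∂p_l` (that is, `∂/∂A_l`) on `FormalFun`, at fixed base coordinates. -/
def dFibre (l : Fin d) (F : FormalFun 𝕜 U) : FormalFun 𝕜 U :=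
  PowerSeries.mk fun n => MvPolynomial.pderiv l (PowerSeries.coeff n F)

/-- The homogeneous polynomial `c^{k_1 ⋯ k_n} p_{k_1} ⋯ p_{k_n}` (summed over all indices). -/
def tensorPoly {n : ℕ} (c : (Fin n → Fin d) → SmoothFun 𝕜 U) : FibrePoly 𝕜 U :=
  ∑ k : Fin n → Fin d, MvPolynomial.C (c k) * ∏ a : Fin n, MvPolynomial.X (k a)

/-- Symmetry of a tensor `c^{k_1 ⋯ k_n}` in all its indices. -/
def IsSymm {R : Type*} {n : ℕ} (c : (Fin n → Fin d) → R) : Prop :=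
  ∀ (σ : Equiv.Perm (Fin n)) (k : Fin n → Fin d), c (k ∘ σ) = c k

/-- The components `Π^{ijk}` of the Jacobiator of the bivector with components `θ^{ij}`. -/
def jacobiator (θ : Fin d → Fin d → SmoothFun 𝕜 U) (i j k : Fin d) : SmoothFun 𝕜 U :=
  (3 : 𝕜)⁻¹ • ∑ l : Fin d,
    (θ i l * pd l (θ j k) + θ k l * pd l (θ i j) + θ j l * pd l (θ k i))

/-- The bracket on `FormalFun` of the bivector with
`{x^i, x^j} = t Θ^{ij}`, `{x^i, p_j} = δ^i_j + t γ_j^i`, `{p_i, p_j} = 0`.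
The lower index of `γ` is its first argument. -/
def bracket (Θ γ : Fin d → Fin d → FormalFun 𝕜 U) (F G : FormalFun 𝕜 U) : FormalFun 𝕜 U :=
  ∑ i : Fin d, ∑ j : Fin d,
    (PowerSeries.X * Θ i j * dBase i F * dBase j G
      + ((if i = j then 1 else 0) + PowerSeries.X * γ j i)
        * (dBase i F * dFibre j G - dFibre j F * dBase i G))

/-- Labels of the coefficient functions of a local symplectic embedding:
`theta n i j k` stands for `θ^{ij|k_1 ⋯ k_n}` and
`gamma n i j k` for `γ_i^{j|k_1 ⋯ k_{n+1}}`. -/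
inductive CoeffIndex (d : ℕ) where
  | theta (n : ℕ) (i j : Fin d) (k : Fin n → Fin d) : CoeffIndex d
  | gamma (n : ℕ) (i j : Fin d) (k : Fin (n + 1) → Fin d) : CoeffIndex d

variable (U) in
/-- A local symplectic embedding of the almost Poisson structure
`θ = ½ θ^{ij} ∂_i ∧ ∂_j` on `U`: a formal Poisson structure on `T^*U`, polynomial on the fibres,
of the form
`{x^i, x^j} = t Θ^{ij}(x,p)`, `{x^i, p_j} = δ^i_j + t γ_j^i(x,p)`, `{p_i, p_j} = 0`, with
`Θ^{ij} = θ^{ij} - t Π^{ijk} p_k + ∑_{n ≥ 2} t^n θ^{ij|k_1 ⋯ k_n} p_{k_1} ⋯ p_{k_n}` and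
`γ_i^j = ∑_{n ≥ 1} t^{n-1} γ_i^{j|k_1 ⋯ k_n} p_{k_1} ⋯ p_{k_n}`. -/
structure SymplecticEmbedding (θ : Fin d → Fin d → SmoothFun 𝕜 U) where
  coeff : CoeffIndex d → SmoothFun 𝕜 U
  theta_symm : ∀ n i j, IsSymm fun k => coeff (.theta n i j k)
  gamma_symm : ∀ n i j, IsSymm fun k => coeff (.gamma n i j k)
  theta_skew : ∀ n i j k, coeff (.theta n j i k) = -coeff (.theta n i j k)
  theta_zero : ∀ i j k, coeff (.theta 0 i j k) = θ i j
  theta_one : ∀ i j k, coeff (.theta 1 i j k) = -jacobiator θ i j (k 0)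
  /-- The Jacobi identity of the cosymplectic bracket. -/
  jacobi :
    let br := bracket
      (fun i j => PowerSeries.mk fun n => tensorPoly fun k => coeff (.theta n i j k))
      (fun i j => PowerSeries.mk fun n => tensorPoly fun k => coeff (.gamma n i j k))
    ∀ F G H : FormalFun 𝕜 U, br F (br G H) + br G (br H F) + br H (br F G) = 0

namespace SymplecticEmbedding

variable {θ : Fin d → Fin d → SmoothFun 𝕜 U} (E : SymplecticEmbedding U θ)

/-- The series `Θ^{ij}(A)`, in the fibre coordinates `A`. -/
def Theta (i j : Fin d) : FormalFun 𝕜 U :=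
  PowerSeries.mk fun n => tensorPoly fun k => E.coeff (.theta n i j k)

/-- The series `γ_i^j(A)`: lower index first. -/
def Gamma (i j : Fin d) : FormalFun 𝕜 U :=
  PowerSeries.mk fun n => tensorPoly fun k => E.coeff (.gamma n i j k)

/-- The local first order differential equation on the jet space for functions `Λ^{ij}(A)`,
all derivatives `dBase` being taken at fixed `A`.  It is the part of the closure relations of the
Lagrangian multipliers `L_f^i = t^2 L^{ij} ∂_j f` that is free of derivatives of the gauge field
and of second derivatives of the gauge parameters.  The last line comes from
`t^2 (∂L^{kj}/∂(∂_m A_l)) ∂_m (t γ_l^i(A)) ∂_i f ∂_j g` in the variation of `L_g`, where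
`∂L^{kj}/∂(∂_m A_l) = -t^2 Λ^{km} Λ^{lj}` at `∂A = 0`. -/
def MultiplierEquation (Λ : Fin d → Fin d → FormalFun 𝕜 U) : Prop :=
  let t : FormalFun 𝕜 U := PowerSeries.X
  let Θ := E.Theta
  let γ := E.Gamma
  ∀ i j k : Fin d,
    t * (dFibre i (Λ k j) - dFibre j (Λ k i))
      + t ^ 3 * ∑ l, (Λ l j * dBase l (Λ k i) - Λ l i * dBase l (Λ k j))
    = -dFibre k (Θ i j)
      + t ^ 2 * ∑ l, (Λ k l * dBase l (Θ i j)
          + Λ l i * dFibre k (γ l j) - Λ l j * dFibre k (γ l i)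
          + Θ j l * dBase l (Λ k i) - Θ i l * dBase l (Λ k j)
          + γ l j * dFibre l (Λ k i) - γ l i * dFibre l (Λ k j))
      + t ^ 4 * ∑ l, ∑ m, (γ m l * Λ m i * dBase l (Λ k j) - γ m l * Λ m j * dBase l (Λ k i))
      + t ^ 4 * ∑ l, ∑ m, (Λ k m * Λ l j * dBase m (γ l i) - Λ k m * Λ l i * dBase m (γ l j))

end SymplecticEmbedding

/-! ### The coefficient tensors `Υ` and the series `Λ` -/

variable (d) in
/-- Families `Υ^{ijl|k_1 ⋯ k_n}`, `n ≥ 1`, with values in `R`: the entry `Υ n i j l k` is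
`Υ^{ijl|k_1 ⋯ k_{n+1}}`. -/
abbrev UpsilonFamily (R : Type*) :=
  ∀ n : ℕ, Fin d → Fin d → Fin d → (Fin (n + 1) → Fin d) → R

/-- The polynomial `Υ^{ijl|k_1 ⋯ k_{n+1}} A_{k_1} ⋯ A_{k_{n+1}}`. -/
def upsilonPoly (Υ : UpsilonFamily d (SmoothFun 𝕜 U)) (n : ℕ) (i j l : Fin d) : FibrePoly 𝕜 U :=
  tensorPoly (Υ n i j l)

/-- `Λ^{ij}(A) = -½ Π^{ijk} A_k
  - ∑_{n ≥ 1} t^n/(n+2) Υ^{ijl|k_1 ⋯ k_n} A_l A_{k_1} ⋯ A_{k_n}`. -/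
def lambdaSeries (θ : Fin d → Fin d → SmoothFun 𝕜 U) (Υ : UpsilonFamily d (SmoothFun 𝕜 U))
    (i j : Fin d) : FormalFun 𝕜 U :=
  PowerSeries.mk fun
    | 0 => -((2 : 𝕜)⁻¹ • ∑ k, MvPolynomial.C (jacobiator θ i j k) * MvPolynomial.X k)
    | n + 1 => -(((n : 𝕜) + 3)⁻¹ • ∑ l, MvPolynomial.X l * upsilonPoly Υ n i j l)

/-- The requirements on the coefficient tensors `Υ`. -/
structure IsUpsilon {θ : Fin d → Fin d → SmoothFun 𝕜 U} (E : SymplecticEmbedding U θ)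
    (Υ : UpsilonFamily d (SmoothFun 𝕜 U)) : Prop where
  /-- symmetry of `Υ^{ijl|k_1 ⋯ k_n}` in `k_1, …, k_n` -/
  symm : ∀ n i j l, IsSymm (Υ n i j l)
  /-- skew-symmetry in `j, l` -/
  skew : ∀ n i j l k, Υ n i l j k = -Υ n i j l k
  /-- the integrability condition at each order -/
  integrable : ∀ n i j l m,
    MvPolynomial.pderiv m (upsilonPoly Υ n i j l) + MvPolynomial.pderiv j (upsilonPoly Υ n i l m)
      + MvPolynomial.pderiv l (upsilonPoly Υ n i m j) = 0
  /-- the resulting `Λ` solves the differential equation to all orders in `t` -/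
  equation : E.MultiplierEquation (lambdaSeries θ Υ)

end Fibre

/-! ### Universal differential polynomials -/

section DiffPoly

/-- Differential polynomials with rational coefficients in functions labelled by `σ`: the variable `([i_1, …, i_r], s)` stands for
`∂_{i_1} ⋯ ∂_{i_r} a_s`. -/
abbrev DiffPoly (d : ℕ) (σ : Type*) := MvPolynomial (List (Fin d) × σ) ℚ

variable {𝕜 : Type*} [RCLike 𝕜] {d : ℕ} {U : TopologicalSpace.Opens (Fin d → ℝ)} {σ : Type*}

/-- The value of a differential polynomial at a family `a_s` of smooth functions on `U`. -/
def DiffPoly.value (P : DiffPoly d σ) (a : σ → SmoothFun 𝕜 U) : SmoothFun 𝕜 U :=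
  MvPolynomial.aeval (fun v : List (Fin d) × σ => v.1.foldr pd (a v.2)) P

end DiffPoly

end AlmostPoisson

end

open scoped ContDiff BigOperators

noncomputable section

namespace AlmostPoisson

/-! ### The involutivity defect of a frame of vector fields -/

section Involutivity

variable {A : Type*} [CommRing A]

/-! Put L = t²Λ and let Z^i = {x^i, ·} + L^{mi} {p_m, ·}. The commutator of Z^i and Z^j is a
combination of the Z^l and of the {p_k, ·} (`frameZ_lie_frameZ`), and its {p_k, ·}-components, the
defect S, equal t times the difference of the two sides of (*) (`defect_eq_multiplier`). So (*) says
that the distribution spanned by the Z^i is involutive.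

Write (*) as t · curl Λ = u(Λ). Order t^{n+1} prescribes the fibrewise curl of the t^n coefficient
of Λ, and the prescribed value involves only lower coefficients (`multiplierRHS_contracting`). The
obstruction is closedness of that value. It is supplied by the Jacobi identity for the Z^i: if S
vanishes modulo t^N, its leading coefficient is closed in the fibre variables
(`IsPerturbation.bianchi`). The curl part of S is closed automatically, hence so is the part coming
from u. The Poincaré lemma with the radial homotopy (`homotopy_formula`) then yields a potential,
and the prescribed shape of Λ is exactly the output of this homotopy.

The solution is therefore defined without reference to integrability, as the unique t-adic fixed
point of the radial homotopy applied to u (`radialSolution`). The Jacobi identity enters only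
afterwards, to show that the fixed point solves (*) (`radialSolution_spec`). Conversely,
integrability makes any admissible Υ the curl of its own Λ, so that Λ is a fixed point too, which
gives uniqueness (`IsUpsilon.eq_universal`).

The fixed point exists over every commutative ℚ-algebra with derivations and is natural under ring
homomorphisms commuting with them (`formalMap_radialSolution`). Carrying out the construction over
differential polynomials and evaluating gives the universal expressions. -/

theorem lie_smul_derivation (D E : Derivation ℤ A A) (f : A) :
    ⁅D, f • E⁆ = D f • E + f • ⁅D, E⁆ := by
  ext g
  simp only [Derivation.commutator_apply, Derivation.smul_apply, Derivation.add_apply,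
    Derivation.leibniz, smul_eq_mul]
  ring

theorem smul_lie_derivation (D E : Derivation ℤ A A) (f : A) :
    ⁅f • D, E⁆ = -(E f • D) + f • ⁅D, E⁆ := by
  ext g
  simp only [Derivation.commutator_apply, Derivation.smul_apply, Derivation.add_apply,
    Derivation.neg_apply, Derivation.leibniz, smul_eq_mul]
  ring

theorem sum_derivation_apply {ι : Type*} (s : Finset ι) (D : ι → Derivation ℤ A A) (f : A) :
    (∑ l ∈ s, D l) f = ∑ l ∈ s, D l f := by
  classical
  induction s using Finset.induction_on with
  | empty => simp
  | insert i s hi ih => simp [Finset.sum_insert hi, ih]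

variable {ι : Type*} [Fintype ι] (a b : ι → Derivation ℤ A A) (Θ ρ : ι → ι → A)

/-- The vector field `{x^i, ·}`. -/
def hamX (i : ι) : Derivation ℤ A A := ∑ l, Θ i l • a l + ∑ l, ρ l i • b l

/-- The vector field `{p_m, ·}`. -/
def hamP (m : ι) : Derivation ℤ A A := -∑ l, ρ m l • a l

/-- The Hamiltonian vector field `{f, ·}`. -/
def ham (f : A) : Derivation ℤ A A := ∑ l, a l f • hamX a b Θ ρ l + ∑ l, b l f • hamP a ρ l

/-- The structure equations of the Hamiltonian vector fields of the coordinates. -/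
structure StructureEquations : Prop where
  xx : ∀ i j, ⁅hamX a b Θ ρ i, hamX a b Θ ρ j⁆ = ham a b Θ ρ (Θ i j)
  xp : ∀ i m, ⁅hamX a b Θ ρ i, hamP a ρ m⁆ = ham a b Θ ρ (ρ m i)
  pp : ∀ m n, ⁅hamP a ρ m, hamP a ρ n⁆ = 0

variable (L : ι → ι → A)

/-- The vector field dual to the form `dx^i + L^{mi} dp_m`. -/
def frameZ (i : ι) : Derivation ℤ A A := hamX a b Θ ρ i + ∑ m, L m i • hamP a ρ m

/-- The vector field `∂^k - L^{kl} ∂_l`. -/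
def frameY (k : ι) : Derivation ℤ A A := b k - ∑ l, L k l • a l

/-- The component of `⁅Z^i, Z^j⁆` along `{p_k, ·}`. -/
def defect (k i j : ι) : A :=
  frameZ a b Θ ρ L i (L k j) - frameZ a b Θ ρ L j (L k i) + frameY a b L k (Θ i j)
    + ∑ l, (L l j * frameY a b L k (ρ l i) - L l i * frameY a b L k (ρ l j))

/-- The component of `⁅Z^i, Z^j⁆` along `Z^l`. -/
def frameC (i j l : ι) : A :=
  a l (Θ i j) + ∑ n, (L n j * a l (ρ n i) - L n i * a l (ρ n j))

/-- Substituting {x^l, ·} = Z^l - L^{ml} {p_m, ·} shifts the coefficient of {p_k, ·} from b_k f to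
b_k f - L^{kl} a_l f, which is why `frameY` appears in the defect. -/
theorem ham_eq_frame (f : A) :
    ham a b Θ ρ f = ∑ l, a l f • frameZ a b Θ ρ L l + ∑ k, frameY a b L k f • hamP a ρ k := by
  simp only [ham, frameZ, frameY, smul_add, Finset.sum_add_distrib, Derivation.sub_apply,
    sum_derivation_apply, Derivation.smul_apply, sub_smul, Finset.sum_sub_distrib, Finset.smul_sum,
    Finset.sum_smul, smul_smul, smul_eq_mul]
  rw [Finset.sum_comm (f := fun k l => (L k l * a l f) • hamP a ρ k)]
  simp only [mul_comm (L _ _)]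
  abel

variable {a b Θ ρ}

theorem frameZ_lie_hamX (h : StructureEquations a b Θ ρ) (i j : ι) :
    ⁅frameZ a b Θ ρ L i, hamX a b Θ ρ j⁆ = ham a b Θ ρ (Θ i j)
      - ∑ m, (hamX a b Θ ρ j (L m i) • hamP a ρ m + L m i • ham a b Θ ρ (ρ m j)) := by
  have h' : ∀ m, ⁅hamP a ρ m, hamX a b Θ ρ j⁆ = -ham a b Θ ρ (ρ m j) := fun m => by
    rw [← lie_skew, h.xp]
  simp only [frameZ, add_lie, sum_lie, h.xx, smul_lie_derivation, h', smul_neg,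
    Finset.sum_add_distrib, Finset.sum_neg_distrib]
  abel

theorem frameZ_lie_hamP (h : StructureEquations a b Θ ρ) (i n : ι) :
    ⁅frameZ a b Θ ρ L i, hamP a ρ n⁆ = ham a b Θ ρ (ρ n i)
      - ∑ m, hamP a ρ n (L m i) • hamP a ρ m := by
  simp only [frameZ, add_lie, sum_lie, h.xp, smul_lie_derivation, h.pp, smul_zero, add_zero,
    Finset.sum_neg_distrib]
  abel

/-- Brackets of coordinate Hamiltonian fields are again Hamiltonian, so the commutator consists of
derivatives of L times {p_k, ·} and of Hamiltonian fields of Θ and ρ. Expanding the latter in the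
frame separates the two kinds of components. -/
theorem frameZ_lie_frameZ (h : StructureEquations a b Θ ρ) (i j : ι) :
    ⁅frameZ a b Θ ρ L i, frameZ a b Θ ρ L j⁆
      = ∑ k, defect a b Θ ρ L k i j • hamP a ρ k + ∑ l, frameC a Θ ρ L i j l • frameZ a b Θ ρ L l := by
  have e1 : ⁅frameZ a b Θ ρ L i, frameZ a b Θ ρ L j⁆
      = ⁅frameZ a b Θ ρ L i, hamX a b Θ ρ j⁆
        + ∑ n, (frameZ a b Θ ρ L i (L n j) • hamP a ρ n
          + L n j • ⁅frameZ a b Θ ρ L i, hamP a ρ n⁆) := by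
    conv_lhs => rw [show frameZ a b Θ ρ L j = hamX a b Θ ρ j + ∑ m, L m j • hamP a ρ m from rfl]
    simp only [lie_add, lie_sum, lie_smul_derivation]
  -- The bracket with {x^j, ·} differentiates L^{mi} only along {x^j, ·}; the missing part of
  -- Z^j(L^{mi}) comes from the brackets with {p_n, ·}, weighted by L^{nj}.
  have e2 : ∑ m, frameZ a b Θ ρ L j (L m i) • hamP a ρ m
      = ∑ m, hamX a b Θ ρ j (L m i) • hamP a ρ m
        + ∑ n, L n j • ∑ m, hamP a ρ n (L m i) • hamP a ρ m := by
    simp only [Finset.smul_sum]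
    rw [Finset.sum_comm, ← Finset.sum_add_distrib]
    refine Finset.sum_congr rfl fun m _ => ?_
    simp only [frameZ, Derivation.add_apply, sum_derivation_apply, Derivation.smul_apply,
      add_smul, Finset.sum_smul, smul_smul, smul_eq_mul]
  have e3 : ⁅frameZ a b Θ ρ L i, frameZ a b Θ ρ L j⁆
      = ∑ k, frameZ a b Θ ρ L i (L k j) • hamP a ρ k - ∑ k, frameZ a b Θ ρ L j (L k i) • hamP a ρ k
        + ham a b Θ ρ (Θ i j) + ∑ n, L n j • ham a b Θ ρ (ρ n i)
        - ∑ n, L n i • ham a b Θ ρ (ρ n j) := by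
    rw [e1, e2, frameZ_lie_hamX L h]
    simp only [frameZ_lie_hamP L h, smul_sub, Finset.sum_add_distrib, Finset.sum_sub_distrib]
    abel
  have e4 : ∀ (c : ι → A) (r : ι → A), ∑ n, c n • ham a b Θ ρ (r n)
      = ∑ l, (∑ n, c n * a l (r n)) • frameZ a b Θ ρ L l
        + ∑ k, (∑ n, c n * frameY a b L k (r n)) • hamP a ρ k := by
    intro c r
    simp only [ham_eq_frame a b Θ ρ L, smul_add, Finset.sum_add_distrib, Finset.smul_sum,
      smul_smul, Finset.sum_smul]
    congr 1 <;> exact Finset.sum_comm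
  rw [e3, e4, e4, ham_eq_frame a b Θ ρ L]
  simp only [defect, frameC, add_smul, sub_smul, Finset.sum_add_distrib, Finset.sum_sub_distrib]
  abel

end Involutivity

/-! ### The Bianchi identity to leading order -/

section Bianchi

variable {A : Type*} [CommRing A] {T : A}

theorem derivation_pow_eq_zero {D : Derivation ℤ A A} (hD : D T = 0) (N : ℕ) : D (T ^ N) = 0 := by
  simp [Derivation.leibniz_pow, hD]

theorem derivation_pow_mul {D : Derivation ℤ A A} (hD : D T = 0) (N : ℕ) (f : A) :
    D (T ^ N * f) = T ^ N * D f := by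
  simp [Derivation.leibniz, derivation_pow_eq_zero hD]

theorem derivation_mul_left {D : Derivation ℤ A A} (hD : D T = 0) (f : A) :
    D (T * f) = T * D f := by
  simp [Derivation.leibniz, hD]

theorem dvd_derivation {D : Derivation ℤ A A} (hD : D T = 0) {N : ℕ} {f : A} (h : T ^ N ∣ f) :
    T ^ N ∣ D f := by
  obtain ⟨g, rfl⟩ := h
  exact ⟨D g, derivation_pow_mul hD N g⟩

/-- A vector killed by `1 + T g` modulo `T ^ M` vanishes modulo `T ^ M`. -/
theorem dvd_of_dvd_add_mul {ι : Type*} [Fintype ι] {M : ℕ} {v : ι → A} {g : ι → ι → A}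
    (h : ∀ n, T ^ M ∣ v n + T * ∑ l, g n l * v l) (n : ι) : T ^ M ∣ v n := by
  suffices H : ∀ r ≤ M, ∀ n, T ^ r ∣ v n from H M le_rfl n
  intro r
  induction r with
  | zero => intro _ n; simp
  | succ r ih =>
    intro hr n
    have h1 : T ^ (r + 1) ∣ T * ∑ l, g n l * v l := by
      rw [pow_succ']
      exact mul_dvd_mul_left _ (Finset.dvd_sum fun l _ => (ih (by omega) l).mul_left _)
    exact (dvd_add_left h1).1 ((pow_dvd_pow T hr).trans (h n))

variable {ι : Type*} [Fintype ι] [DecidableEq ι] {a b : ι → Derivation ℤ A A}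
  {Θ ρ γ L : ι → ι → A}

/-- The hypotheses expressing that the bracket and `L` are perturbations of the canonical ones. -/
structure IsPerturbation (T : A) (a b : ι → Derivation ℤ A A) (Θ ρ γ L : ι → ι → A) : Prop where
  base : ∀ l, a l T = 0
  fibre : ∀ l, b l T = 0
  theta : ∀ i j, T ∣ Θ i j
  rho : ∀ m i, ρ m i = (if i = m then 1 else 0) + T * γ m i
  mult : ∀ i j, T ∣ L i j

namespace IsPerturbation

omit [Fintype ι] in
theorem derivation_rho (h : IsPerturbation T a b Θ ρ γ L) {D : Derivation ℤ A A} (hD : D T = 0)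
    (m i : ι) : T ∣ D (ρ m i) := by
  rw [h.rho, map_add]
  refine dvd_add ?_ ⟨_, derivation_mul_left hD _⟩
  split_ifs <;> simp

theorem hamP_base (h : IsPerturbation T a b Θ ρ γ L) (i : ι) : hamP a ρ i T = 0 := by
  simp [hamP, sum_derivation_apply, h.base]

theorem frameC_dvd (h : IsPerturbation T a b Θ ρ γ L) (i j l : ι) :
    T ∣ frameC a Θ ρ L i j l := by
  refine dvd_add ?_ (Finset.dvd_sum fun n _ => dvd_sub ?_ ?_)
  · obtain ⟨g, hg⟩ := h.theta i j
    exact ⟨a l g, by rw [hg, derivation_mul_left (h.base l)]⟩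
  · exact (h.derivation_rho (h.base l) _ _).mul_left _
  · exact (h.derivation_rho (h.base l) _ _).mul_left _

theorem frameZ_lie_hamP_dvd (h : IsPerturbation T a b Θ ρ γ L)
    (hs : StructureEquations a b Θ ρ) (i n : ι) (f : A) :
    T ∣ ⁅frameZ a b Θ ρ L i, hamP a ρ n⁆ f := by
  rw [frameZ_lie_hamP L hs]
  simp only [ham, Derivation.sub_apply, Derivation.add_apply, sum_derivation_apply,
    Derivation.smul_apply, smul_eq_mul]
  refine dvd_sub (dvd_add ?_ ?_) ?_ <;> refine Finset.dvd_sum fun l _ => Dvd.dvd.mul_right ?_ _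
  · exact h.derivation_rho (h.base l) _ _
  · exact h.derivation_rho (h.fibre l) _ _
  · obtain ⟨g, hg⟩ := h.mult l i
    exact ⟨hamP a ρ n g, by rw [hg, derivation_mul_left (h.hamP_base n)]⟩

/-- At T = 0 the field Z^i reduces to the fibre derivative. Every correction carries a factor T from
Θ, Tγ or L, and the derivations that occur kill T, so they preserve divisibility by T^N. -/
theorem frameZ_sub_fibre_dvd (h : IsPerturbation T a b Θ ρ γ L) {N : ℕ} {f : A} (hf : T ^ N ∣ f)
    (i : ι) : T ^ (N + 1) ∣ frameZ a b Θ ρ L i f - b i f := by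
  have e : frameZ a b Θ ρ L i f - b i f = ∑ l, Θ i l * a l f + ∑ l, T * γ l i * b l f
      + ∑ m, L m i * hamP a ρ m f := by
    simp only [frameZ, hamX, Derivation.add_apply, sum_derivation_apply, Derivation.smul_apply,
      smul_eq_mul, h.rho, add_mul, ite_mul, one_mul, zero_mul, Finset.sum_add_distrib,
      Finset.sum_ite_eq, Finset.mem_univ, if_true]
    ring
  rw [e, pow_succ']
  refine dvd_add (dvd_add ?_ ?_) ?_ <;> refine Finset.dvd_sum fun l _ => mul_dvd_mul ?_ ?_
  · exact h.theta _ _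
  · exact dvd_derivation (h.base l) hf
  · exact dvd_mul_right _ _
  · exact dvd_derivation (h.fibre l) hf
  · exact h.mult _ _
  · exact dvd_derivation (h.hamP_base l) hf

/-- The Leibniz rule leaves three error terms: (Z^m - b_m) applied to S, S times the bracket of Z^m
with {p_k, ·}, and C times S. Each gains one order, since Z^m - b_m raises the order and both that
bracket and C are divisible by T. -/
theorem frameZ_lie_lie_dvd (h : IsPerturbation T a b Θ ρ γ L)
    (hs : StructureEquations a b Θ ρ) {N : ℕ} (hS : ∀ k i j, T ^ N ∣ defect a b Θ ρ L k i j)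
    (m i j : ι) (f : A) :
    T ^ (N + 1) ∣ ⁅frameZ a b Θ ρ L m, ⁅frameZ a b Θ ρ L i, frameZ a b Θ ρ L j⁆⁆ f
      - (∑ k, b m (defect a b Θ ρ L k i j) * hamP a ρ k f
        + ∑ n, (frameZ a b Θ ρ L m (frameC a Θ ρ L i j n)
          + ∑ l, frameC a Θ ρ L i j l * frameC a Θ ρ L m l n) * frameZ a b Θ ρ L n f) := by
  have e : ⁅frameZ a b Θ ρ L m, ⁅frameZ a b Θ ρ L i, frameZ a b Θ ρ L j⁆⁆ f
      - (∑ k, b m (defect a b Θ ρ L k i j) * hamP a ρ k f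
        + ∑ n, (frameZ a b Θ ρ L m (frameC a Θ ρ L i j n)
          + ∑ l, frameC a Θ ρ L i j l * frameC a Θ ρ L m l n) * frameZ a b Θ ρ L n f)
      = ∑ k, (frameZ a b Θ ρ L m (defect a b Θ ρ L k i j) - b m (defect a b Θ ρ L k i j))
            * hamP a ρ k f
        + ∑ k, ⁅frameZ a b Θ ρ L m, hamP a ρ k⁆ f * defect a b Θ ρ L k i j
        + ∑ l, ∑ k, frameC a Θ ρ L i j l * defect a b Θ ρ L k m l * hamP a ρ k f := by
    have e' : ∑ n, (∑ l, frameC a Θ ρ L i j l * frameC a Θ ρ L m l n) * frameZ a b Θ ρ L n f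
        = ∑ l, ∑ n, frameC a Θ ρ L i j l * frameC a Θ ρ L m l n * frameZ a b Θ ρ L n f := by
      rw [Finset.sum_comm]
      simp only [Finset.sum_mul]
    rw [frameZ_lie_frameZ L hs i j]
    simp only [lie_add, lie_sum, lie_smul_derivation, Derivation.add_apply, sum_derivation_apply,
      Derivation.smul_apply, smul_eq_mul, add_mul, sub_mul, Finset.sum_add_distrib,
      Finset.sum_sub_distrib, e', frameZ_lie_frameZ L hs m, mul_add, Finset.mul_sum, mul_assoc,
      mul_comm (⁅frameZ a b Θ ρ L m, hamP a ρ _⁆ f)]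
    abel
  rw [e]
  refine dvd_add (dvd_add ?_ ?_) ?_
  · exact Finset.dvd_sum fun k _ => (h.frameZ_sub_fibre_dvd (hS k i j) m).mul_right _
  · rw [pow_succ']
    exact Finset.dvd_sum fun k _ => mul_dvd_mul (h.frameZ_lie_hamP_dvd hs m k f) (hS k i j)
  · rw [pow_succ']
    exact Finset.dvd_sum fun l _ => Finset.dvd_sum fun k _ =>
      (mul_dvd_mul (h.frameC_dvd i j l) (hS k m l)).mul_right _

/-- If the involutivity defect vanishes modulo `T ^ N`, its leading coefficient is closed. -/
theorem bianchi (h : IsPerturbation T a b Θ ρ γ L)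
    (hs : StructureEquations a b Θ ρ) {x p : ι → A}
    (hax : ∀ l i, a l (x i) = if i = l then 1 else 0)
    (hap : ∀ l i, a l (p i) = 0) (hbp : ∀ l i, b l (p i) = if i = l then 1 else 0)
    {N : ℕ} (hS : ∀ k i j, T ^ N ∣ defect a b Θ ρ L k i j) (k m i j : ι) :
    T ^ (N + 1) ∣ b m (defect a b Θ ρ L k i j) + b i (defect a b Θ ρ L k j m)
      + b j (defect a b Θ ρ L k m i) := by
  set Z := frameZ a b Θ ρ L
  set C := frameC a Θ ρ L
  set S := defect a b Θ ρ L
  set w : ι → A := fun k => b m (S k i j) + b i (S k j m) + b j (S k m i) with hw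
  set B : ι → ι → ι → ι → A := fun m i j n => Z m (C i j n) + ∑ l, C i j l * C m l n with hB
  set v : ι → A := fun n => B m i j n + B i j m n + B j m i n with hv
  -- The cyclic sum of the double commutators is zero by the Jacobi identity for derivations, so
  -- only the leading-order frame expansion survives.
  have key : ∀ f, T ^ (N + 1) ∣ ∑ k, w k * hamP a ρ k f + ∑ n, v n * Z n f := by
    intro f
    have hd := dvd_add (dvd_add (h.frameZ_lie_lie_dvd hs hS m i j f)
      (h.frameZ_lie_lie_dvd hs hS i j m f)) (h.frameZ_lie_lie_dvd hs hS j m i f)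
    rw [← dvd_neg] at hd
    convert hd using 1
    have hj : ⁅Z m, ⁅Z i, Z j⁆⁆ f + ⁅Z i, ⁅Z j, Z m⁆⁆ f + ⁅Z j, ⁅Z m, Z i⁆⁆ f = 0 := by
      rw [← Derivation.add_apply, ← Derivation.add_apply, lie_jacobi, Derivation.zero_apply]
    simp only [hw, hv, hB, add_mul, Finset.sum_add_distrib] at hj ⊢
    linear_combination hj
  have hPp : ∀ k n, hamP a ρ k (p n) = 0 := fun k n => by
    simp [hamP, sum_derivation_apply, hap]
  have hZp : ∀ l n, Z l (p n) = ρ n l := fun l n => by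
    simp [Z, frameZ, hamX, sum_derivation_apply, hap, hPp, hbp]
  have hPx : ∀ k n, hamP a ρ k (x n) = -ρ k n := fun k n => by
    simp [hamP, sum_derivation_apply, hax]
  -- Testing on the fibre coordinates kills the {p_k, ·} terms and leaves v contracted with 1 + Tγ,
  -- which is invertible to every order in T.
  have hv0 : ∀ n, T ^ (N + 1) ∣ v n := by
    refine dvd_of_dvd_add_mul (g := fun n l => γ n l) fun n => ?_
    have := key (p n)
    simp only [hPp, hZp, h.rho, mul_zero, Finset.sum_const_zero, zero_add, mul_add, mul_ite, mul_one,
      Finset.sum_add_distrib, Finset.sum_ite_eq', Finset.mem_univ, if_true] at this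
    convert this using 2
    rw [Finset.mul_sum]
    exact Finset.sum_congr rfl fun l _ => by ring
  -- With v negligible, testing on the base coordinates isolates w in the same way.
  have hw0 : ∀ n, T ^ (N + 1) ∣ w n := by
    refine dvd_of_dvd_add_mul (g := fun n l => γ l n) fun n => ?_
    have h1 := (dvd_add_left (Finset.dvd_sum fun l _ => (hv0 l).mul_right (Z l (x n)))).1 (key (x n))
    simp only [hPx, h.rho, mul_neg, Finset.sum_neg_distrib, dvd_neg, mul_add, mul_ite, mul_one,
      mul_zero, Finset.sum_add_distrib, Finset.sum_ite_eq, Finset.mem_univ, if_true] at h1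
    convert h1 using 2
    rw [Finset.mul_sum]
    exact Finset.sum_congr rfl fun l _ => by ring
  exact hw0 k

end IsPerturbation

end Bianchi

/-! ### The multiplier equation as an involutivity condition -/

section MultiplierDefect

variable {A : Type*} [CommRing A] {ι : Type*} [Fintype ι] [DecidableEq ι]
  {a b : ι → Derivation ℤ A A} {Θ ρ : ι → ι → A}

omit [DecidableEq ι] in
theorem ham_skew (hΘ : ∀ i j, Θ j i = -Θ i j) (f g : A) :
    ham a b Θ ρ g f = -ham a b Θ ρ f g := by
  simp only [ham, hamX, hamP, Derivation.add_apply, sum_derivation_apply, Derivation.smul_apply,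
    Derivation.neg_apply, smul_eq_mul, mul_add, Finset.sum_add_distrib, Finset.mul_sum, mul_neg,
    Finset.sum_neg_distrib]
  rw [Finset.sum_comm (f := fun i j => a i g * (Θ i j * a j f)),
    Finset.sum_comm (f := fun i j => a i g * (ρ j i * b j f)),
    Finset.sum_comm (f := fun i j => b i g * (ρ i j * a j f))]
  have h1 : ∑ y, ∑ x, a x g * (Θ x y * a y f) = -∑ x, ∑ y, a x f * (Θ x y * a y g) := by
    simp only [← Finset.sum_neg_distrib]
    refine Finset.sum_congr rfl fun y _ => Finset.sum_congr rfl fun x _ => ?_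
    rw [hΘ y x]
    ring
  have h2 : ∀ u v : A, ∑ y, ∑ x, a x u * (ρ y x * b y v) = ∑ x, ∑ y, b x v * (ρ x y * a y u) :=
    fun u v => Finset.sum_congr rfl fun y _ => Finset.sum_congr rfl fun x _ => by ring
  have h3 : ∑ y, ∑ x, b x g * (ρ x y * a y f) = ∑ x, ∑ y, a x f * (ρ y x * b y g) :=
    Finset.sum_congr rfl fun y _ => Finset.sum_congr rfl fun x _ => by ring
  rw [h1, h2, h3]
  ring

/-- For a skew bracket the Jacobi identity says that f ↦ {f, ·} respects brackets. The structure
equations are this statement for the coordinates, whose Hamiltonian fields are `hamX` and `hamP`. -/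
theorem structureEquations_of_jacobi (hΘ : ∀ i j, Θ j i = -Θ i j)
    (hJ : ∀ f g h, ham a b Θ ρ f (ham a b Θ ρ g h) + ham a b Θ ρ g (ham a b Θ ρ h f)
      + ham a b Θ ρ h (ham a b Θ ρ f g) = 0)
    {x p : ι → A} (hax : ∀ l i, a l (x i) = if i = l then 1 else 0) (hbx : ∀ l i, b l (x i) = 0)
    (hap : ∀ l i, a l (p i) = 0) (hbp : ∀ l i, b l (p i) = if i = l then 1 else 0) :
    StructureEquations a b Θ ρ := by
  have hx : ∀ i, ham a b Θ ρ (x i) = hamX a b Θ ρ i := fun i => by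
    simp [ham, hax, hbx]
  have hp : ∀ i, ham a b Θ ρ (p i) = hamP a ρ i := fun i => by
    simp [ham, hap, hbp]
  have hl : ∀ f g, ⁅ham a b Θ ρ f, ham a b Θ ρ g⁆ = ham a b Θ ρ (ham a b Θ ρ f g) := by
    intro f g
    ext h
    have h1 := hJ f g h
    rw [ham_skew hΘ f h, ham_skew hΘ (ham a b Θ ρ f g) h, map_neg] at h1
    rw [Derivation.commutator_apply]
    linear_combination h1
  refine ⟨fun i j => ?_, fun i m => ?_, fun m n => ?_⟩
  · rw [← hx i, ← hx j, hl, hx i]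
    congr 1
    simp [hamX, sum_derivation_apply, hax, hbx]
  · rw [← hx i, ← hp m, hl, hx i]
    congr 1
    simp [hamX, sum_derivation_apply, hap, hbp]
  · rw [← hp m, ← hp n, hl, hp m]
    have : hamP a ρ m (p n) = 0 := by simp [hamP, sum_derivation_apply, hap]
    rw [this]
    simp [ham]

theorem ham_apply_eq (t : A) (Θ γ : ι → ι → A) (f g : A) :
    ham a b (fun i j => t * Θ i j) (fun m i => (if i = m then 1 else 0) + t * γ m i) f g
      = ∑ i, ∑ j, (t * Θ i j * a i f * a j g
        + ((if i = j then 1 else 0) + t * γ j i) * (a i f * b j g - b j f * a i g)) := by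
  simp only [ham, hamX, hamP, Derivation.add_apply, Derivation.neg_apply,
    sum_derivation_apply, Derivation.smul_apply, smul_eq_mul]
  have e1 : ∑ l, a l f * (∑ m, t * Θ l m * a m g
        + ∑ m, ((if l = m then 1 else 0) + t * γ m l) * b m g)
      = ∑ l, ∑ m, (t * Θ l m * a l f * a m g
        + ((if l = m then 1 else 0) + t * γ m l) * (a l f * b m g)) := by
    refine Finset.sum_congr rfl fun l _ => ?_
    rw [← Finset.sum_add_distrib, Finset.mul_sum]
    exact Finset.sum_congr rfl fun m _ => by ring
  have e2 : ∑ l, b l f * -∑ m, ((if m = l then 1 else 0) + t * γ l m) * a m g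
      = -∑ l, ∑ m, ((if l = m then 1 else 0) + t * γ m l) * (b m f * a l g) := by
    rw [Finset.sum_comm]
    simp only [mul_neg, Finset.sum_neg_distrib, Finset.mul_sum]
    refine congrArg Neg.neg (Finset.sum_congr rfl fun l _ => Finset.sum_congr rfl fun m _ => ?_)
    ring
  rw [e1, e2, ← sub_eq_add_neg, ← Finset.sum_sub_distrib]
  refine Finset.sum_congr rfl fun l _ => ?_
  rw [← Finset.sum_sub_distrib]
  exact Finset.sum_congr rfl fun m _ => by ring

/-- The multiplier equation, solved for `t (∂^i Λ^{kj} - ∂^j Λ^{ki})`. -/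
def multiplierRHS (a b : ι → Derivation ℤ A A) (t : A) (Θ γ Λ : ι → ι → A) (k i j : ι) : A :=
  -b k (Θ i j)
    + t ^ 2 * ∑ l, (Λ k l * a l (Θ i j)
        + Λ l i * b k (γ l j) - Λ l j * b k (γ l i)
        + Θ j l * a l (Λ k i) - Θ i l * a l (Λ k j)
        + γ l j * b l (Λ k i) - γ l i * b l (Λ k j))
    + t ^ 4 * ∑ l, ∑ m, (γ m l * Λ m i * a l (Λ k j) - γ m l * Λ m j * a l (Λ k i))
    + t ^ 4 * ∑ l, ∑ m, (Λ k m * Λ l j * a m (γ l i) - Λ k m * Λ l i * a m (γ l j))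
    - t ^ 3 * ∑ l, (Λ l j * a l (Λ k i) - Λ l i * a l (Λ k j))

theorem defect_eq_multiplier {t : A} (hat : ∀ l, a l t = 0) (hbt : ∀ l, b l t = 0)
    (Θ γ Λ : ι → ι → A) (k i j : ι) :
    defect a b (fun i j => t * Θ i j) (fun m i => (if i = m then 1 else 0) + t * γ m i)
        (fun i j => t ^ 2 * Λ i j) k i j
      = t * (t * (b i (Λ k j) - b j (Λ k i)) - multiplierRHS a b t Θ γ Λ k i j) := by
  have hd : ∀ (D : Derivation ℤ A A) (i j : ι), D (if i = j then (1 : A) else 0) = 0 := by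
    intro D i j
    split_ifs <;> simp
  have hZ : ∀ i j, frameZ a b (fun i j => t * Θ i j)
      (fun m i => (if i = m then 1 else 0) + t * γ m i) (fun i j => t ^ 2 * Λ i j) i (t ^ 2 * Λ k j)
      = t ^ 3 * ∑ l, Θ i l * a l (Λ k j) + t ^ 2 * b i (Λ k j) + t ^ 3 * ∑ l, γ l i * b l (Λ k j)
        - t ^ 4 * ∑ l, Λ l i * a l (Λ k j)
        - t ^ 5 * ∑ l, ∑ m, γ m l * Λ m i * a l (Λ k j) := by
    intro i j
    simp only [frameZ, hamX, hamP, Derivation.add_apply, Derivation.neg_apply,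
      sum_derivation_apply, Derivation.smul_apply, smul_eq_mul, derivation_pow_mul (hat _),
      derivation_pow_mul (hbt _), add_mul, ite_mul, one_mul, zero_mul, Finset.sum_add_distrib,
      Finset.sum_ite_eq, Finset.sum_ite_eq', Finset.mem_univ, if_true, mul_neg, mul_add,
      Finset.mul_sum, Finset.sum_neg_distrib, neg_add]
    have e1 : ∑ l, t * Θ i l * (t ^ 2 * a l (Λ k j)) = ∑ l, t ^ 3 * (Θ i l * a l (Λ k j)) :=
      Finset.sum_congr rfl fun _ _ => by ring
    have e2 : ∑ l, t * γ l i * (t ^ 2 * b l (Λ k j)) = ∑ l, t ^ 3 * (γ l i * b l (Λ k j)) :=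
      Finset.sum_congr rfl fun _ _ => by ring
    have e3 : ∑ l, t ^ 2 * Λ l i * (t ^ 2 * a l (Λ k j)) = ∑ l, t ^ 4 * (Λ l i * a l (Λ k j)) :=
      Finset.sum_congr rfl fun _ _ => by ring
    have e4 : ∑ m, ∑ l, t ^ 2 * Λ m i * (t * γ m l * (t ^ 2 * a l (Λ k j)))
        = ∑ l, ∑ m, t ^ 5 * (γ m l * Λ m i * a l (Λ k j)) := by
      rw [Finset.sum_comm]
      exact Finset.sum_congr rfl fun _ _ => Finset.sum_congr rfl fun _ _ => by ring
    rw [e1, e2, e3, e4]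
    ring
  have hY1 : frameY a b (fun i j => t ^ 2 * Λ i j) k (t * Θ i j)
      = t * b k (Θ i j) - t ^ 3 * ∑ l, Λ k l * a l (Θ i j) := by
    simp only [frameY, Derivation.sub_apply, sum_derivation_apply, Derivation.smul_apply,
      smul_eq_mul, derivation_mul_left (hat _), derivation_mul_left (hbt _), Finset.mul_sum]
    congr 1
    exact Finset.sum_congr rfl fun _ _ => by ring
  have hY2 : ∀ i j, ∑ l, t ^ 2 * Λ l j * frameY a b (fun i j => t ^ 2 * Λ i j) k
        ((if i = l then 1 else 0) + t * γ l i)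
      = t ^ 3 * ∑ l, Λ l j * b k (γ l i) - t ^ 5 * ∑ l, ∑ m, Λ k m * Λ l j * a m (γ l i) := by
    intro i j
    simp only [frameY, Derivation.sub_apply, sum_derivation_apply, Derivation.smul_apply,
      smul_eq_mul, map_add, hd, zero_add, derivation_mul_left (hat _), derivation_mul_left (hbt _),
      Finset.mul_sum, mul_sub, Finset.sum_sub_distrib]
    congr 1
    · exact Finset.sum_congr rfl fun _ _ => by ring
    · exact Finset.sum_congr rfl fun _ _ => Finset.sum_congr rfl fun _ _ => by ring
  simp only [defect, hZ, hY1, Finset.sum_sub_distrib, hY2, multiplierRHS, Finset.sum_add_distrib]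
  ring

omit [DecidableEq ι] in
theorem multiplierRHS_skew {t : A} {Θ γ : ι → ι → A} (hΘ : ∀ i j, Θ j i = -Θ i j)
    (Λ : ι → ι → A) (k i j : ι) :
    multiplierRHS a b t Θ γ Λ k j i = -multiplierRHS a b t Θ γ Λ k i j := by
  simp only [multiplierRHS, hΘ i j, map_neg, Finset.sum_add_distrib, Finset.sum_sub_distrib,
    mul_neg, Finset.sum_neg_distrib]
  ring

theorem dvd_mul_sub_mul {T : A} {f f' g g' : A} (hf : T ∣ f - f') (hg : T ∣ g - g') :
    T ∣ f * g - f' * g' := by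
  have e : f * g - f' * g' = (f - f') * g + f' * (g - g') := by ring
  rw [e]
  exact dvd_add (hf.mul_right _) (hg.mul_left _)

omit [DecidableEq ι] in
/-- The right hand side of the multiplier equation depends on `Λ` only two orders below. -/
theorem multiplierRHS_contracting {t : A} (hat : ∀ l, a l t = 0) (hbt : ∀ l, b l t = 0)
    (Θ γ : ι → ι → A) {Λ Λ' : ι → ι → A} {N : ℕ} (h : ∀ i j, t ^ N ∣ Λ i j - Λ' i j)
    (k i j : ι) :
    t ^ (N + 2) ∣ multiplierRHS a b t Θ γ Λ k i j - multiplierRHS a b t Θ γ Λ' k i j := by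
  have ha : ∀ l i j, t ^ N ∣ a l (Λ i j) - a l (Λ' i j) := fun l i j => by
    rw [← map_sub]; exact dvd_derivation (hat l) (h i j)
  have hb : ∀ l i j, t ^ N ∣ b l (Λ i j) - b l (Λ' i j) := fun l i j => by
    rw [← map_sub]; exact dvd_derivation (hbt l) (h i j)
  have hc : ∀ c : A, t ^ N ∣ c - c := fun c => by simp
  have hadd : ∀ {f f' g g' : A}, t ^ N ∣ f - f' → t ^ N ∣ g - g' → t ^ N ∣ f + g - (f' + g') :=
    fun hf hg => by rw [add_sub_add_comm]; exact dvd_add hf hg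
  have hsub : ∀ {f f' g g' : A}, t ^ N ∣ f - f' → t ^ N ∣ g - g' → t ^ N ∣ f - g - (f' - g') :=
    fun hf hg => by rw [sub_sub_sub_comm]; exact dvd_sub hf hg
  have hsum : ∀ {f f' : ι → A}, (∀ l, t ^ N ∣ f l - f' l) → t ^ N ∣ ∑ l, f l - ∑ l, f' l :=
    fun hf => by rw [← Finset.sum_sub_distrib]; exact Finset.dvd_sum fun l _ => hf l
  -- All dependence on Λ sits behind a factor t². The cofactor is polynomial in Λ and its first
  -- derivatives, so it preserves congruence modulo t^N.
  have e : ∀ Λ : ι → ι → A, multiplierRHS a b t Θ γ Λ k i j = -b k (Θ i j) + t ^ 2 *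
      (∑ l, (Λ k l * a l (Θ i j)
        + Λ l i * b k (γ l j) - Λ l j * b k (γ l i)
        + Θ j l * a l (Λ k i) - Θ i l * a l (Λ k j)
        + γ l j * b l (Λ k i) - γ l i * b l (Λ k j))
      + t ^ 2 * ∑ l, ∑ m, (γ m l * Λ m i * a l (Λ k j) - γ m l * Λ m j * a l (Λ k i))
      + t ^ 2 * ∑ l, ∑ m, (Λ k m * Λ l j * a m (γ l i) - Λ k m * Λ l i * a m (γ l j))
      - t * ∑ l, (Λ l j * a l (Λ k i) - Λ l i * a l (Λ k j))) := fun Λ => by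
    rw [multiplierRHS]; ring
  rw [e, e, add_sub_add_left_eq_sub, ← mul_sub, pow_add, mul_comm]
  refine mul_dvd_mul_left _ (hsub (hadd (hadd (hsum fun l => ?_)
    (dvd_mul_sub_mul (hc _) (hsum fun l => hsum fun m => ?_)))
    (dvd_mul_sub_mul (hc _) (hsum fun l => hsum fun m => ?_)))
    (dvd_mul_sub_mul (hc _) (hsum fun l => ?_)))
  · exact hsub (hadd (hsub (hadd (hsub (hadd (dvd_mul_sub_mul (h _ _) (hc _))
      (dvd_mul_sub_mul (h _ _) (hc _))) (dvd_mul_sub_mul (h _ _) (hc _)))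
      (dvd_mul_sub_mul (hc _) (ha _ _ _))) (dvd_mul_sub_mul (hc _) (ha _ _ _)))
      (dvd_mul_sub_mul (hc _) (hb _ _ _))) (dvd_mul_sub_mul (hc _) (hb _ _ _))
  · exact hsub (dvd_mul_sub_mul (dvd_mul_sub_mul (hc _) (h _ _)) (ha _ _ _))
      (dvd_mul_sub_mul (dvd_mul_sub_mul (hc _) (h _ _)) (ha _ _ _))
  · exact hsub (dvd_mul_sub_mul (dvd_mul_sub_mul (h _ _) (h _ _)) (hc _))
      (dvd_mul_sub_mul (dvd_mul_sub_mul (h _ _) (h _ _)) (hc _))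
  · exact hsub (dvd_mul_sub_mul (h _ _) (ha _ _ _)) (dvd_mul_sub_mul (h _ _) (ha _ _ _))

omit [DecidableEq ι] in
/-- Naturality of the right hand side of the multiplier equation. -/
theorem map_multiplierRHS {A' : Type*} [CommRing A'] (φ : A →+* A')
    {a' b' : ι → Derivation ℤ A' A'} (ha : ∀ l f, φ (a l f) = a' l (φ f))
    (hb : ∀ l f, φ (b l f) = b' l (φ f)) (t : A) (Θ γ Λ : ι → ι → A) (k i j : ι) :
    φ (multiplierRHS a b t Θ γ Λ k i j)
      = multiplierRHS a' b' (φ t) (fun i j => φ (Θ i j)) (fun i j => φ (γ i j))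
          (fun i j => φ (Λ i j)) k i j := by
  simp only [multiplierRHS, map_add, map_sub, map_neg, map_mul, map_pow, map_sum, ha, hb]

end MultiplierDefect

/-! ### Coefficientwise derivations -/

/-- Derivations of a commutative ring over `ℤ`. -/
abbrev IntDer (A : Type*) [CommRing A] := Derivation ℤ A A

/-- An additive map satisfying the Leibniz rule, as a derivation. -/
def IntDer.mk {A : Type*} [CommRing A] (D : A → A) (hadd : ∀ f g, D (f + g) = D f + D g)
    (hmul : ∀ f g, D (f * g) = f * D g + g * D f) : IntDer A :=
  Derivation.mk' (AddMonoidHom.mk' D hadd).toIntLinearMap hmul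

section CoefficientDerivations

variable {R S σ : Type*} [CommRing R] [CommRing S]

theorem coeff_sum_support_monomial (D : IntDer R) (f : MvPolynomial σ R) (m : σ →₀ ℕ) :
    MvPolynomial.coeff m (∑ u ∈ f.support, MvPolynomial.monomial u (D (f.coeff u)))
      = D (f.coeff m) := by
  classical
  rw [MvPolynomial.coeff_sum]
  simp only [MvPolynomial.coeff_monomial, Finset.sum_ite_eq', MvPolynomial.mem_support_iff]
  split_ifs with h
  · rfl
  · rw [not_not.1 h, map_zero]

/-- The action of a derivation on the coefficients of polynomials. -/
def polyDer (D : IntDer R) : IntDer (MvPolynomial σ R) :=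
  IntDer.mk (fun f => ∑ u ∈ f.support, MvPolynomial.monomial u (D (f.coeff u)))
    (fun f g => by
      ext m
      rw [MvPolynomial.coeff_add]
      simp only [coeff_sum_support_monomial]
      rw [MvPolynomial.coeff_add, map_add])
    (fun f g => by
      classical
      ext m
      rw [coeff_sum_support_monomial, mul_comm g]
      simp only [MvPolynomial.coeff_add, MvPolynomial.coeff_mul, coeff_sum_support_monomial,
        map_sum, Derivation.leibniz, Finset.sum_add_distrib, smul_eq_mul,
        mul_comm (MvPolynomial.coeff _ g)])

theorem coeff_polyDer (D : IntDer R) (f : MvPolynomial σ R) (m : σ →₀ ℕ) :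
    MvPolynomial.coeff m (polyDer D f) = D (f.coeff m) :=
  coeff_sum_support_monomial D f m

/-- The action of a derivation on the coefficients of power series. -/
def seriesDer (D : IntDer S) : IntDer (PowerSeries S) :=
  IntDer.mk (fun f => PowerSeries.mk fun n => D (PowerSeries.coeff n f))
    (fun f g => by ext; simp)
    (fun f g => by
      ext n
      rw [mul_comm g]
      simp only [PowerSeries.coeff_mk, map_add, PowerSeries.coeff_mul, map_sum,
        Derivation.leibniz, Finset.sum_add_distrib, smul_eq_mul,
        mul_comm (PowerSeries.coeff _ g)])

theorem coeff_seriesDer (D : IntDer S) (f : PowerSeries S) (n : ℕ) :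
    PowerSeries.coeff n (seriesDer D f) = D (PowerSeries.coeff n f) :=
  PowerSeries.coeff_mk n fun n => D (PowerSeries.coeff n f)

theorem seriesDer_X (D : IntDer S) : seriesDer D PowerSeries.X = 0 := by
  ext n
  rw [coeff_seriesDer, PowerSeries.coeff_X]
  split_ifs <;> simp

theorem seriesDer_C (D : IntDer S) (s : S) :
    seriesDer D (PowerSeries.C s) = PowerSeries.C (D s) := by
  ext n
  rw [coeff_seriesDer, PowerSeries.coeff_C, PowerSeries.coeff_C]
  split_ifs <;> simp

/-- Differentiation along the base at fixed fibre coordinates. -/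
def baseDer (D : IntDer R) :
    IntDer (PowerSeries (MvPolynomial σ R)) :=
  seriesDer (polyDer D)

variable (R) in
/-- Differentiation along the fibre at fixed base coordinates. -/
def fibreDer (l : σ) :
    IntDer (PowerSeries (MvPolynomial σ R)) :=
  seriesDer (IntDer.mk (MvPolynomial.pderiv l) (map_add _) (MvPolynomial.pderiv l).leibniz)

theorem coeff_fibreDer (l : σ) (F : PowerSeries (MvPolynomial σ R)) (n : ℕ) :
    PowerSeries.coeff n (fibreDer R l F) = MvPolynomial.pderiv l (PowerSeries.coeff n F) :=
  coeff_seriesDer _ _ _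

theorem fibreDer_C (l : σ) (f : MvPolynomial σ R) :
    fibreDer R l (PowerSeries.C f) = PowerSeries.C (MvPolynomial.pderiv l f) :=
  seriesDer_C _ f

theorem fibreDer_C_X [DecidableEq σ] (l i : σ) :
    fibreDer R l (PowerSeries.C (MvPolynomial.X i)) = if i = l then 1 else 0 := by
  rw [fibreDer_C, MvPolynomial.pderiv_X]
  by_cases h : i = l <;> simp [h]

theorem baseDer_C_C [DecidableEq σ] {D : σ → IntDer R} {ξ : σ → R}
    (hξ : ∀ l i, D l (ξ i) = if i = l then 1 else 0) (l i : σ) :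
    baseDer (σ := σ) (D l) (PowerSeries.C (MvPolynomial.C (ξ i))) = if i = l then 1 else 0 := by
  have : polyDer (σ := σ) (D l) (MvPolynomial.C (ξ i)) = if i = l then 1 else 0 := by
    ext v
    rw [coeff_polyDer, MvPolynomial.coeff_C]
    by_cases hv : 0 = v
    · rw [if_pos hv, hξ, ← hv]
      by_cases hil : i = l <;> simp [hil]
    · rw [if_neg hv, map_zero]
      by_cases hil : i = l <;> simp [hil, MvPolynomial.coeff_one, hv]
  rw [baseDer, seriesDer_C, this]
  split_ifs <;> simp

theorem baseDer_C_X (D : σ → IntDer R) (l i : σ) :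
    baseDer (σ := σ) (D l) (PowerSeries.C (MvPolynomial.X i)) = 0 := by
  classical
  have : polyDer (σ := σ) (D l) (MvPolynomial.X i) = 0 := by
    ext v
    rw [coeff_polyDer, MvPolynomial.coeff_X]
    split_ifs <;> simp
  rw [baseDer, seriesDer_C, this, map_zero]

/-- The ring homomorphism on formal functions induced by one of coefficient rings. -/
abbrev formalMap (φ : R →+* S) :
    PowerSeries (MvPolynomial σ R) →+* PowerSeries (MvPolynomial σ S) :=
  PowerSeries.map (MvPolynomial.map φ)

theorem formalMap_baseDer (φ : R →+* S) {D : IntDer R} {D' : IntDer S}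
    (h : ∀ r, φ (D r) = D' (φ r)) (F : PowerSeries (MvPolynomial σ R)) :
    formalMap φ (baseDer D F) = baseDer D' (formalMap φ F) := by
  ext n m
  simp [baseDer, coeff_seriesDer, coeff_polyDer, MvPolynomial.coeff_map, h]

theorem formalMap_fibreDer (φ : R →+* S) (l : σ) (F : PowerSeries (MvPolynomial σ R)) :
    formalMap φ (fibreDer R l F) = fibreDer S l (formalMap φ F) := by
  ext n m
  simp [coeff_fibreDer, MvPolynomial.pderiv_map]

theorem pderiv_comm_apply (i j : σ) (f : MvPolynomial σ R) :
    MvPolynomial.pderiv i (MvPolynomial.pderiv j f)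
      = MvPolynomial.pderiv j (MvPolynomial.pderiv i f) := by
  classical
  ext m
  simp only [MvPolynomial.coeff_pderiv, Finsupp.add_apply, add_right_comm m]
  by_cases h : i = j
  · subst h; rfl
  · simp [h, Ne.symm h]
    ring

/-- The homotopy formula for closed homogeneous two-forms. -/
theorem homotopy_formula [Fintype σ] {u : σ → σ → MvPolynomial σ R} {n : ℕ}
    (hskew : ∀ j l, u l j = -u j l) (hhom : ∀ j l, (u j l).IsHomogeneous n)
    (hclosed : ∀ j l m, MvPolynomial.pderiv m (u j l) + MvPolynomial.pderiv j (u l m)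
      + MvPolynomial.pderiv l (u m j) = 0) (i j : σ) :
    MvPolynomial.pderiv i (∑ l, MvPolynomial.X l * u j l)
      - MvPolynomial.pderiv j (∑ l, MvPolynomial.X l * u i l) = -((n + 2 : ℕ) • u i j) := by
  classical
  have hd : ∀ i j, MvPolynomial.pderiv i (∑ l, MvPolynomial.X l * u j l)
      = ∑ l, MvPolynomial.X l * MvPolynomial.pderiv i (u j l) + u j i := by
    intro i j
    simp [Derivation.leibniz, MvPolynomial.pderiv_X, Finset.sum_add_distrib, Pi.single_apply]
  have he := (hhom i j).sum_X_mul_pderiv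
  -- Closedness turns the curl terms into the Euler operator, which contributes n; the product-rule
  -- terms u_{ji} - u_{ij} contribute the remaining 2.
  have hc : ∑ l, MvPolynomial.X l * MvPolynomial.pderiv i (u j l)
      - ∑ l, MvPolynomial.X l * MvPolynomial.pderiv j (u i l)
      = -∑ l, MvPolynomial.X l * MvPolynomial.pderiv l (u i j) := by
    rw [← Finset.sum_sub_distrib, ← Finset.sum_neg_distrib]
    refine Finset.sum_congr rfl fun l _ => ?_
    have h1 := hclosed i j l
    rw [hskew i l, map_neg] at h1
    linear_combination MvPolynomial.X l * h1
  rw [hd, hd, hskew i j]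
  rw [he] at hc
  rw [add_smul]
  linear_combination (norm := module) hc

/-- The normalized homotopy formula for closed homogeneous two-forms. -/
theorem homotopy_formula_smul [Algebra ℚ R] [Fintype σ] {u : σ → σ → MvPolynomial σ R} {n : ℕ}
    (hskew : ∀ j l, u l j = -u j l) (hhom : ∀ j l, (u j l).IsHomogeneous n)
    (hclosed : ∀ j l m, MvPolynomial.pderiv m (u j l) + MvPolynomial.pderiv j (u l m)
      + MvPolynomial.pderiv l (u m j) = 0) (i j : σ) :
    MvPolynomial.pderiv i (-(((n : ℚ) + 2)⁻¹ • ∑ l, MvPolynomial.X l * u j l))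
      - MvPolynomial.pderiv j (-(((n : ℚ) + 2)⁻¹ • ∑ l, MvPolynomial.X l * u i l)) = u i j := by
  have hq : ((n : ℚ) + 2)⁻¹ * ((n + 2 : ℕ) : ℚ) = 1 := by
    push_cast
    exact inv_mul_cancel₀ (by positivity)
  have hq' : ∀ (i : σ) (f : MvPolynomial σ R), MvPolynomial.pderiv i
      (((n : ℚ) + 2)⁻¹ • f) = ((n : ℚ) + 2)⁻¹ • MvPolynomial.pderiv i f :=
    fun i f => map_rat_smul (MvPolynomial.pderiv (R := R) i) _ f
  rw [map_neg, map_neg, hq', hq', neg_sub_neg, ← smul_sub, ← neg_sub,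
    homotopy_formula hskew hhom hclosed, neg_neg, ← Nat.cast_smul_eq_nsmul ℚ, smul_smul, hq,
    one_smul]

end CoefficientDerivations

/-! ### Graded formal functions -/

section Graded

variable {R σ : Type*} [CommRing R]

/-- The coefficient of `t^n` is homogeneous of degree `n + s`. -/
def IsGraded (s : ℤ) (F : PowerSeries (MvPolynomial σ R)) : Prop :=
  ∀ n m, MvPolynomial.coeff m (PowerSeries.coeff n F) ≠ 0 → (m.degree : ℤ) = n + s

namespace IsGraded

variable {s s' : ℤ} {F G : PowerSeries (MvPolynomial σ R)}

theorem zero : IsGraded s (0 : PowerSeries (MvPolynomial σ R)) := fun n m h => by simp at h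

theorem add (hF : IsGraded s F) (hG : IsGraded s G) : IsGraded s (F + G) := fun n m h => by
  by_cases h1 : MvPolynomial.coeff m (PowerSeries.coeff n F) = 0
  · refine hG n m fun h2 => h ?_
    simp [h1, h2]
  · exact hF n m h1

theorem neg (hF : IsGraded s F) : IsGraded s (-F) := fun n m h => by
  refine hF n m fun h1 => h ?_
  simp [h1]

theorem sub (hF : IsGraded s F) (hG : IsGraded s G) : IsGraded s (F - G) := by
  rw [sub_eq_add_neg]; exact hF.add hG.neg

theorem sum {ι : Type*} {I : Finset ι} {F : ι → PowerSeries (MvPolynomial σ R)}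
    (hF : ∀ i, IsGraded s (F i)) : IsGraded s (∑ i ∈ I, F i) :=
  Finset.sum_induction _ _ (fun _ _ => add) zero fun i _ => hF i

theorem mul (hF : IsGraded s F) (hG : IsGraded s' G) : IsGraded (s + s') (F * G) := fun n m h => by
  classical
  rw [PowerSeries.coeff_mul, MvPolynomial.coeff_sum] at h
  obtain ⟨⟨n1, n2⟩, hn, h1⟩ := Finset.exists_ne_zero_of_sum_ne_zero h
  rw [MvPolynomial.coeff_mul] at h1
  obtain ⟨⟨m1, m2⟩, hm, h2⟩ := Finset.exists_ne_zero_of_sum_ne_zero h1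
  rw [Finset.HasAntidiagonal.mem_antidiagonal] at hn hm
  have e1 := hF n1 m1 (left_ne_zero_of_mul h2)
  have e2 := hG n2 m2 (right_ne_zero_of_mul h2)
  dsimp only at hn hm
  rw [← hm, ← hn, map_add]
  push_cast
  rw [e1, e2]
  ring

theorem X : IsGraded (-1) (PowerSeries.X : PowerSeries (MvPolynomial σ R)) := fun n m h => by
  classical
  rw [PowerSeries.coeff_X] at h
  split_ifs at h with hn
  · rw [MvPolynomial.coeff_one] at h
    have : m = 0 := by by_contra h'; exact h (if_neg fun e => h' e.symm)
    simp [this, hn]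
  · simp at h

theorem X_pow (r : ℕ) :
    IsGraded (-r) ((PowerSeries.X : PowerSeries (MvPolynomial σ R)) ^ r) := by
  induction r with
  | zero =>
    intro n m h
    classical
    rw [pow_zero, PowerSeries.coeff_one] at h
    split_ifs at h with hn
    · rw [MvPolynomial.coeff_one] at h
      have : m = 0 := by by_contra h'; exact h (if_neg fun e => h' e.symm)
      simp [this, hn]
    · simp at h
  | succ r ih =>
    rw [pow_succ]
    convert ih.mul X using 1
    push_cast
    ring

theorem baseDer (hF : IsGraded s F) (D : IntDer R) : IsGraded s (baseDer D F) :=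
  fun n m h => by
    refine hF n m fun h1 => h ?_
    simp [AlmostPoisson.baseDer, coeff_seriesDer, coeff_polyDer, h1]

theorem fibreDer (hF : IsGraded s F) (l : σ) : IsGraded (s - 1) (fibreDer R l F) :=
  fun n m h => by
    rw [coeff_fibreDer, MvPolynomial.coeff_pderiv] at h
    have h1 := hF n _ (left_ne_zero_of_mul h)
    simp at h1
    linarith

theorem isHomogeneous (hF : IsGraded s F) {n k : ℕ} (h : (n : ℤ) + s = k) :
    (PowerSeries.coeff n F).IsHomogeneous k := fun m hm => by
  have := hF n m hm
  rw [Finsupp.degree_eq_weight_one] at this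
  exact_mod_cast this.trans h

/-- Both t and the fibre derivatives have weight -1, and every term of (*) balances. Hence the
t^{n+1} coefficient has fibre degree n, as the homotopy formula requires, and the t^0 coefficient
vanishes. -/
theorem multiplierRHS [Fintype σ] (D : σ → IntDer R)
    {Θ γ Λ : σ → σ → PowerSeries (MvPolynomial σ R)} (hΘ : ∀ i j, IsGraded 0 (Θ i j))
    (hγ : ∀ i j, IsGraded 1 (γ i j)) (hΛ : ∀ i j, IsGraded 1 (Λ i j)) (k i j : σ) :
    IsGraded (-1) (multiplierRHS (fun l => AlmostPoisson.baseDer (D l))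
      (AlmostPoisson.fibreDer R) PowerSeries.X Θ γ Λ k i j) := by
  have h2 := X_pow (R := R) (σ := σ) 2
  have h3 := X_pow (R := R) (σ := σ) 3
  have h4 := X_pow (R := R) (σ := σ) 4
  refine sub (add (add (add (neg ((hΘ i j).fibreDer k)) (h2.mul (s' := 1) (sum fun l => ?_)))
    (h4.mul (s' := 3) (sum fun l => sum fun m => ?_)))
    (h4.mul (s' := 3) (sum fun l => sum fun m => ?_))) (h3.mul (s' := 2) (sum fun l => ?_))
  · exact sub (add (sub (add (sub (add ((hΛ k l).mul ((hΘ i j).baseDer _))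
      ((hΛ l i).mul ((hγ l j).fibreDer _))) ((hΛ l j).mul ((hγ l i).fibreDer _)))
      ((hΘ j l).mul ((hΛ k i).baseDer _))) ((hΘ i l).mul ((hΛ k j).baseDer _)))
      ((hγ l j).mul ((hΛ k i).fibreDer _))) ((hγ l i).mul ((hΛ k j).fibreDer _))
  · exact sub (((hγ m l).mul (hΛ m i)).mul ((hΛ k j).baseDer _))
      (((hγ m l).mul (hΛ m j)).mul ((hΛ k i).baseDer _))
  · exact sub (((hΛ k m).mul (hΛ l j)).mul ((hγ l i).baseDer _))
      (((hΛ k m).mul (hΛ l i)).mul ((hγ l j).baseDer _))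
  · exact sub ((hΛ l j).mul ((hΛ k i).baseDer _)) ((hΛ l i).mul ((hΛ k j).baseDer _))

end IsGraded

end Graded

/-! ### Symmetric tensors and homogeneous polynomials -/

section Tensors

variable {R S : Type*} [CommRing R] [CommRing S] {d n : ℕ}

/-- The exponent of the monomial `X_{k_1} ⋯ X_{k_n}`. -/
def exponent (k : Fin n → Fin d) : Fin d →₀ ℕ := ∑ a, Finsupp.single (k a) 1

/-- The homogeneous polynomial `c^{k_1 ⋯ k_n} X_{k_1} ⋯ X_{k_n}`. -/
def symbolPoly (c : (Fin n → Fin d) → R) : MvPolynomial (Fin d) R :=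
  ∑ k : Fin n → Fin d, MvPolynomial.C (c k) * ∏ a : Fin n, MvPolynomial.X (k a)

/-- The number of index tuples with the same associated monomial. -/
def multiplicity (u : Fin d →₀ ℕ) (n : ℕ) : ℕ :=
  (Finset.univ.filter fun k : Fin n → Fin d => exponent k = u).card

theorem prod_X_eq_monomial (k : Fin n → Fin d) :
    ∏ a : Fin n, (MvPolynomial.X (k a) : MvPolynomial (Fin d) R)
      = MvPolynomial.monomial (exponent k) 1 := by
  simp only [MvPolynomial.X, exponent, MvPolynomial.monomial_sum_one]

theorem coeff_symbolPoly (c : (Fin n → Fin d) → R) (u : Fin d →₀ ℕ) :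
    MvPolynomial.coeff u (symbolPoly c)
      = ∑ k ∈ Finset.univ.filter (fun k : Fin n → Fin d => exponent k = u), c k := by
  classical
  simp [symbolPoly, prod_X_eq_monomial, MvPolynomial.coeff_sum, MvPolynomial.coeff_C_mul,
    MvPolynomial.coeff_monomial, Finset.sum_filter]

theorem symbolPoly_neg (c : (Fin n → Fin d) → R) : symbolPoly (fun k => -c k) = -symbolPoly c := by
  simp [symbolPoly]

theorem degree_exponent (k : Fin n → Fin d) : (exponent k).degree = n := by
  simp [exponent, map_sum]

theorem exponent_apply (k : Fin n → Fin d) (c : Fin d) :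
    exponent k c = Fintype.card {a // k a = c} := by
  classical
  simp [exponent, Finsupp.finsetSum_apply, Finsupp.single_apply, Fintype.card_subtype]

theorem exponent_comp_perm (k : Fin n → Fin d) (σ : Equiv.Perm (Fin n)) :
    exponent (k ∘ σ) = exponent k :=
  Equiv.sum_comp σ fun a => Finsupp.single (k a) 1

/-- The exponents count the fibres of the index tuples; bijections between fibres of equal size glue
to a permutation. -/
theorem exists_perm_of_exponent_eq {k k' : Fin n → Fin d} (h : exponent k' = exponent k) :
    ∃ σ : Equiv.Perm (Fin n), k' = k ∘ σ := by
  have e : ∀ c, Nonempty ({a // k' a = c} ≃ {a // k a = c}) := fun c => by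
    rw [← Fintype.card_eq, ← exponent_apply, ← exponent_apply, h]
  refine ⟨Equiv.ofFiberEquiv fun c => (e c).some, funext fun a => ?_⟩
  exact (Equiv.ofFiberEquiv_map _ a).symm

theorem exists_exponent_eq : ∀ {n : ℕ} (u : Fin d →₀ ℕ), u.degree = n →
    ∃ k : Fin n → Fin d, exponent k = u
  | 0, u, h => ⟨Fin.elim0, by rw [(Finsupp.degree_eq_zero_iff u).1 h]; simp [exponent]⟩
  | n + 1, u, h => by
    have hu : u ≠ 0 := fun h0 => by simp [h0] at h
    obtain ⟨i, hi⟩ := Finsupp.ne_iff.1 hu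
    have hle : Finsupp.single i 1 ≤ u := by
      rw [Finsupp.single_le_iff]
      exact Nat.one_le_iff_ne_zero.2 hi
    obtain ⟨v, rfl⟩ := exists_add_of_le hle
    rw [map_add, Finsupp.degree_single] at h
    obtain ⟨k, hk⟩ := exists_exponent_eq v (show v.degree = n by omega)
    refine ⟨Fin.cons i k, ?_⟩
    rw [exponent, Fin.sum_univ_succ, ← hk]
    simp [exponent]

theorem multiplicity_exponent_ne_zero (k : Fin n → Fin d) : multiplicity (exponent k) n ≠ 0 :=
  Finset.card_ne_zero.2 ⟨k, by simp⟩

variable [Algebra ℚ R] [Algebra ℚ S]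

/-- The symmetric tensor of a homogeneous polynomial of degree `n`. -/
def toTensor (n : ℕ) (f : MvPolynomial (Fin d) R) (k : Fin n → Fin d) : R :=
  (multiplicity (exponent k) n : ℚ)⁻¹ • MvPolynomial.coeff (exponent k) f

theorem toTensor_isSymm (n : ℕ) (f : MvPolynomial (Fin d) R) : IsSymm (toTensor n f) :=
  fun σ k => by rw [toTensor, exponent_comp_perm, toTensor]

theorem toTensor_neg (n : ℕ) (f : MvPolynomial (Fin d) R) (k : Fin n → Fin d) :
    toTensor n (-f) k = -toTensor n f k := by
  simp [toTensor]

theorem map_toTensor (φ : R →+* S) (n : ℕ) (f : MvPolynomial (Fin d) R) (k : Fin n → Fin d) :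
    φ (toTensor n f k) = toTensor n (MvPolynomial.map φ f) k := by
  rw [toTensor, map_rat_smul, toTensor, MvPolynomial.coeff_map]

/-- A coefficient sums c over one permutation orbit of index tuples, where c is constant; dividing
by the orbit size recovers it. -/
theorem toTensor_symbolPoly {c : (Fin n → Fin d) → R} (hc : IsSymm c) :
    toTensor n (symbolPoly c) = c := by
  funext k
  rw [toTensor, coeff_symbolPoly, Finset.sum_congr rfl (g := fun _ => c k), Finset.sum_const,
    ← Nat.cast_smul_eq_nsmul ℚ, smul_smul, ← multiplicity,
    inv_mul_cancel₀ (by exact_mod_cast multiplicity_exponent_ne_zero k), one_smul]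
  intro k' hk'
  obtain ⟨σ, rfl⟩ := exists_perm_of_exponent_eq (Finset.mem_filter.1 hk').2
  exact hc σ k

theorem symbolPoly_toTensor {f : MvPolynomial (Fin d) R} (hf : f.IsHomogeneous n) :
    symbolPoly (toTensor n f) = f := by
  ext u
  rw [coeff_symbolPoly]
  by_cases hu : u.degree = n
  · obtain ⟨k, rfl⟩ := exists_exponent_eq u hu
    rw [Finset.sum_congr rfl (g := fun _ => (multiplicity (exponent k) n : ℚ)⁻¹ •
      MvPolynomial.coeff (exponent k) f), Finset.sum_const, ← Nat.cast_smul_eq_nsmul ℚ, smul_smul,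
      ← multiplicity, mul_inv_cancel₀ (by exact_mod_cast multiplicity_exponent_ne_zero k),
      one_smul]
    intro k' hk'
    rw [toTensor, (Finset.mem_filter.1 hk').2]
  · rw [Finset.filter_false_of_mem, Finset.sum_empty]
    · by_contra h
      refine hu ?_
      rw [Finsupp.degree_eq_weight_one]
      exact hf (Ne.symm h)
    · rintro k - rfl
      exact hu (degree_exponent k)

end Tensors

/-! ### The solution in radial gauge -/

section Solution

variable {R S : Type*} [CommRing R] [CommRing S] {d : ℕ}

/-- The right hand side of the multiplier equation for formal functions over a ring with
derivations `D`. -/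
abbrev formalRHS (D : Fin d → IntDer R)
    (Θ γ Λ : Fin d → Fin d → PowerSeries (MvPolynomial (Fin d) R)) (k i j : Fin d) :
    PowerSeries (MvPolynomial (Fin d) R) :=
  multiplierRHS (fun l => baseDer (D l)) (fibreDer R) PowerSeries.X Θ γ Λ k i j

/-- Comparing with Λ = 0 through the contraction estimate at N = 0 shows that Λ enters only from
order t² on. -/
theorem coeff_one_formalRHS (D : Fin d → IntDer R)
    (Θ γ Λ : Fin d → Fin d → PowerSeries (MvPolynomial (Fin d) R)) (k i j : Fin d) :
    PowerSeries.coeff 1 (formalRHS D Θ γ Λ k i j)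
      = -MvPolynomial.pderiv k (PowerSeries.coeff 1 (Θ i j)) := by
  have h := multiplierRHS_contracting (a := fun l => baseDer (D l)) (b := fibreDer R)
    (t := PowerSeries.X) (fun l => seriesDer_X _) (fun l => seriesDer_X _) Θ γ (Λ := Λ) (Λ' := 0)
    (N := 0) (fun i j => by simp) k i j
  have h1 := PowerSeries.X_pow_dvd_iff.1 h 1 (by norm_num)
  have h0 : multiplierRHS (fun l => baseDer (D l)) (fibreDer R) PowerSeries.X Θ γ 0 k i j
      = -fibreDer R k (Θ i j) := by
    simp [multiplierRHS]
  rw [h0, map_sub, sub_eq_zero] at h1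
  rw [h1, map_neg, coeff_fibreDer]

variable [Algebra ℚ R] [Algebra ℚ S]

/-- The radial homotopy applied to the right hand side of the multiplier equation. -/
def radialStep (D : Fin d → IntDer R)
    (Θ γ Λ : Fin d → Fin d → PowerSeries (MvPolynomial (Fin d) R)) (i j : Fin d) :
    PowerSeries (MvPolynomial (Fin d) R) :=
  -- The factor t on the left of (*) pairs the t^n coefficient of Λ with order n + 1 on the right;
  -- that term has degree n, whence the homotopy constant n + 2.
  PowerSeries.mk fun n => -(((n : ℚ) + 2)⁻¹ •
    ∑ l, MvPolynomial.X l * PowerSeries.coeff (n + 1) (formalRHS D Θ γ Λ i j l))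

/-- The iterates of the radial homotopy. -/
def radialIterate (D : Fin d → IntDer R)
    (Θ γ : Fin d → Fin d → PowerSeries (MvPolynomial (Fin d) R)) :
    ℕ → Fin d → Fin d → PowerSeries (MvPolynomial (Fin d) R)
  | 0 => 0
  | n + 1 => radialStep D Θ γ (radialIterate D Θ γ n)

/-- The fixed point of the radial homotopy. -/
def radialSolution (D : Fin d → IntDer R)
    (Θ γ : Fin d → Fin d → PowerSeries (MvPolynomial (Fin d) R)) (i j : Fin d) :
    PowerSeries (MvPolynomial (Fin d) R) :=
  -- Each iteration fixes one more order, so the t^n coefficient is stable from iterate n + 1 on.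
  PowerSeries.mk fun n => PowerSeries.coeff n (radialIterate D Θ γ (n + 1) i j)

variable {D : Fin d → IntDer R} {Θ γ Λ Λ' : Fin d → Fin d → PowerSeries (MvPolynomial (Fin d) R)}

theorem radialStep_contracting {N : ℕ} (h : ∀ i j, PowerSeries.X ^ N ∣ Λ i j - Λ' i j)
    (i j : Fin d) :
    PowerSeries.X ^ (N + 1) ∣ radialStep D Θ γ Λ i j - radialStep D Θ γ Λ' i j := by
  rw [PowerSeries.X_pow_dvd_iff]
  intro n hn
  have e : ∀ l, PowerSeries.coeff (n + 1) (formalRHS D Θ γ Λ i j l)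
      = PowerSeries.coeff (n + 1) (formalRHS D Θ γ Λ' i j l) := fun l => by
    rw [← sub_eq_zero, ← map_sub]
    exact PowerSeries.X_pow_dvd_iff.1 (multiplierRHS_contracting (a := fun l => baseDer (D l))
      (b := fibreDer R) (fun l => seriesDer_X _) (fun l => seriesDer_X _) Θ γ h i j l) _
      (by omega)
  simp only [radialStep, map_sub, PowerSeries.coeff_mk, e, sub_self]

theorem radialStep_fixed_unique (h : radialStep D Θ γ Λ = Λ) (h' : radialStep D Θ γ Λ' = Λ') :
    Λ = Λ' := by
  have key : ∀ N, ∀ i j, PowerSeries.X ^ N ∣ Λ i j - Λ' i j := by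
    intro N
    induction N with
    | zero => simp
    | succ N ih =>
      intro i j
      have := radialStep_contracting (D := D) (Θ := Θ) (γ := γ) ih i j
      rwa [h, h'] at this
  funext i j
  ext1 n
  rw [← sub_eq_zero, ← map_sub]
  exact PowerSeries.X_pow_dvd_iff.1 (key (n + 1) i j) n n.lt_succ_self

theorem radialIterate_dvd (n r : ℕ) (i j : Fin d) :
    PowerSeries.X ^ n ∣ radialIterate D Θ γ (n + r) i j - radialIterate D Θ γ n i j := by
  induction n generalizing i j with
  | zero => simp
  | succ n ih =>
    rw [Nat.add_right_comm]
    exact radialStep_contracting ih i j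

theorem radialSolution_dvd (n : ℕ) (i j : Fin d) :
    PowerSeries.X ^ n ∣ radialSolution D Θ γ i j - radialIterate D Θ γ n i j := by
  rw [PowerSeries.X_pow_dvd_iff]
  intro m hm
  obtain ⟨r, rfl⟩ := Nat.exists_eq_add_of_le (Nat.succ_le_of_lt hm)
  rw [map_sub, radialSolution, PowerSeries.coeff_mk, ← neg_eq_zero, neg_sub, ← map_sub]
  exact PowerSeries.X_pow_dvd_iff.1 (radialIterate_dvd (m + 1) r i j) m m.lt_succ_self

theorem radialStep_radialSolution :
    radialStep D Θ γ (radialSolution D Θ γ) = radialSolution D Θ γ := by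
  funext i j
  ext1 n
  rw [← sub_eq_zero, ← map_sub]
  refine PowerSeries.X_pow_dvd_iff.1 ?_ n n.lt_succ_self
  have h1 := radialStep_contracting (D := D) (Θ := Θ) (γ := γ)
    (fun i j => radialSolution_dvd (D := D) (Θ := Θ) (γ := γ) n i j) i j
  have h2 := radialSolution_dvd (D := D) (Θ := Θ) (γ := γ) (n + 1) i j
  have h3 := dvd_sub h1 h2
  rwa [show radialStep D Θ γ (radialIterate D Θ γ n) i j = radialIterate D Θ γ (n + 1) i j from rfl,
    sub_sub_sub_cancel_right] at h3

theorem radialStep_isGraded (hΘ : ∀ i j, IsGraded 0 (Θ i j)) (hγ : ∀ i j, IsGraded 1 (γ i j))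
    (hΛ : ∀ i j, IsGraded 1 (Λ i j)) (i j : Fin d) : IsGraded 1 (radialStep D Θ γ Λ i j) := by
  classical
  intro n m h
  have hh : MvPolynomial.IsHomogeneous (PowerSeries.coeff n (radialStep D Θ γ Λ i j)) (n + 1) := by
    rw [radialStep, PowerSeries.coeff_mk, ← neg_smul]
    refine (MvPolynomial.homogeneousSubmodule (Fin d) R (n + 1)).smul_of_tower_mem _ ?_
    refine Submodule.sum_mem _ fun l _ => ?_
    rw [MvPolynomial.mem_homogeneousSubmodule, add_comm n 1]
    exact (MvPolynomial.isHomogeneous_X R l).mul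
      ((IsGraded.multiplierRHS D hΘ hγ hΛ i j l).isHomogeneous (by push_cast; ring))
  have := hh h
  rw [Finsupp.degree_eq_weight_one]
  exact_mod_cast this

theorem radialSolution_isGraded (hΘ : ∀ i j, IsGraded 0 (Θ i j)) (hγ : ∀ i j, IsGraded 1 (γ i j))
    (i j : Fin d) : IsGraded 1 (radialSolution D Θ γ i j) := by
  have key : ∀ n i j, IsGraded 1 (radialIterate D Θ γ n i j) := by
    intro n
    induction n with
    | zero => exact fun i j => IsGraded.zero
    | succ n ih => exact radialStep_isGraded hΘ hγ ih
  intro n m h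
  rw [radialSolution, PowerSeries.coeff_mk] at h
  exact key (n + 1) i j n m h

omit [Algebra ℚ R] [Algebra ℚ S] in
theorem formalMap_formalRHS (φ : R →+* S) {D' : Fin d → IntDer S}
    (h : ∀ l r, φ (D l r) = D' l (φ r)) (k i j : Fin d) :
    formalMap φ (formalRHS D Θ γ Λ k i j)
      = formalRHS D' (fun i j => formalMap φ (Θ i j)) (fun i j => formalMap φ (γ i j))
        (fun i j => formalMap φ (Λ i j)) k i j := by
  rw [formalRHS, map_multiplierRHS (formalMap φ) (fun l => formalMap_baseDer φ (h l))
    (formalMap_fibreDer φ), PowerSeries.map_X]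

/-- The image of the solution is a fixed point of the radial step over the target ring, so
uniqueness of fixed points identifies it. -/
theorem formalMap_radialSolution (φ : R →+* S) {D' : Fin d → IntDer S}
    (h : ∀ l r, φ (D l r) = D' l (φ r)) :
    (fun i j => formalMap φ (radialSolution D Θ γ i j))
      = radialSolution D' (fun i j => formalMap φ (Θ i j)) (fun i j => formalMap φ (γ i j)) := by
  refine radialStep_fixed_unique (D := D') (Θ := fun i j => formalMap φ (Θ i j))
    (γ := fun i j => formalMap φ (γ i j)) ?_ radialStep_radialSolution
  funext i j
  conv_rhs => rw [← radialStep_radialSolution]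
  ext1 n
  simp only [radialStep, PowerSeries.coeff_mk, PowerSeries.coeff_map, ← formalMap_formalRHS φ h,
    map_neg, map_rat_smul (MvPolynomial.map φ), map_sum, map_mul, MvPolynomial.map_X]

/-- In radial gauge the potential of a closed form reproduces it. -/
theorem pderiv_radialStep {n : ℕ} {k : Fin d}
    (hskew : ∀ i j, formalRHS D Θ γ Λ k j i = -formalRHS D Θ γ Λ k i j)
    (hhom : ∀ i j, (PowerSeries.coeff (n + 1) (formalRHS D Θ γ Λ k i j)).IsHomogeneous n)
    (hclosed : ∀ i j m, MvPolynomial.pderiv m (PowerSeries.coeff (n + 1) (formalRHS D Θ γ Λ k i j))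
      + MvPolynomial.pderiv i (PowerSeries.coeff (n + 1) (formalRHS D Θ γ Λ k j m))
      + MvPolynomial.pderiv j (PowerSeries.coeff (n + 1) (formalRHS D Θ γ Λ k m i)) = 0)
    (i j : Fin d) :
    MvPolynomial.pderiv i (PowerSeries.coeff n (radialStep D Θ γ Λ k j))
      - MvPolynomial.pderiv j (PowerSeries.coeff n (radialStep D Θ γ Λ k i))
      = PowerSeries.coeff (n + 1) (formalRHS D Θ γ Λ k i j) := by
  simp only [radialStep, PowerSeries.coeff_mk]
  exact homotopy_formula_smul
    (u := fun i j => PowerSeries.coeff (n + 1) (formalRHS D Θ γ Λ k i j))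
    (fun i j => by rw [hskew i j, map_neg]) hhom hclosed i j

/-- The radial solution solves the multiplier equation, order by order. -/
theorem radialSolution_spec (hΘ : ∀ i j, IsGraded 0 (Θ i j)) (hγ : ∀ i j, IsGraded 1 (γ i j))
    (hskew : ∀ i j, Θ j i = -Θ i j) {ξ : Fin d → R}
    (hξ : ∀ l i, D l (ξ i) = if i = l then 1 else 0)
    (hs : StructureEquations (fun l => baseDer (D l)) (fibreDer R)
      (fun i j => PowerSeries.X * Θ i j)
      (fun m i => (if i = m then 1 else 0) + PowerSeries.X * γ m i))
    (hfix : radialStep D Θ γ Λ = Λ) (hΛ : ∀ i j, IsGraded 1 (Λ i j)) (k i j : Fin d) :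
    PowerSeries.X * (fibreDer R i (Λ k j) - fibreDer R j (Λ k i)) = formalRHS D Θ γ Λ k i j := by
  set u := fun k i j => formalRHS D Θ γ Λ k i j with hu
  have hat : ∀ l, baseDer (σ := Fin d) (D l) PowerSeries.X = 0 := fun l => seriesDer_X _
  have hbt : ∀ l : Fin d, fibreDer R l PowerSeries.X = 0 := fun l => seriesDer_X _
  have husk : ∀ k i j, u k j i = -u k i j := multiplierRHS_skew hskew Λ
  have hug : ∀ k i j, IsGraded (-1) (u k i j) := IsGraded.multiplierRHS D hΘ hγ hΛ
  set F : Fin d → Fin d → Fin d → PowerSeries (MvPolynomial (Fin d) R) := fun k i j =>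
    PowerSeries.X * (fibreDer R i (Λ k j) - fibreDer R j (Λ k i)) - u k i j with hF
  have hF1 : ∀ n k i j, PowerSeries.coeff (n + 1) (F k i j)
      = MvPolynomial.pderiv i (PowerSeries.coeff n (Λ k j))
        - MvPolynomial.pderiv j (PowerSeries.coeff n (Λ k i))
        - PowerSeries.coeff (n + 1) (u k i j) := fun n k i j => by
    simp only [hF, map_sub, PowerSeries.coeff_succ_X_mul, coeff_fibreDer]
  have hpert : IsPerturbation PowerSeries.X (fun l => baseDer (D l)) (fibreDer R)
      (fun i j => PowerSeries.X * Θ i j)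
      (fun m i => (if i = m then 1 else 0) + PowerSeries.X * γ m i) γ
      (fun i j => PowerSeries.X ^ 2 * Λ i j) :=
    ⟨hat, hbt, fun i j => dvd_mul_right _ _, fun m i => rfl,
      fun i j => (dvd_pow_self _ two_ne_zero).mul_right _⟩
  have hdef : ∀ k i j, defect (fun l => baseDer (D l)) (fibreDer R)
      (fun i j => PowerSeries.X * Θ i j)
      (fun m i => (if i = m then 1 else 0) + PowerSeries.X * γ m i)
      (fun i j => PowerSeries.X ^ 2 * Λ i j) k i j = PowerSeries.X * F k i j :=
    defect_eq_multiplier hat hbt Θ γ Λ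
  have key : ∀ N, ∀ k i j, PowerSeries.X ^ N ∣ F k i j := by
    intro N
    induction N with
    | zero => simp
    | succ N ih =>
      suffices h : ∀ k i j, PowerSeries.coeff N (F k i j) = 0 by
        intro k i j
        rw [PowerSeries.X_pow_dvd_iff]
        intro m hm
        rcases Nat.lt_succ_iff_lt_or_eq.1 hm with h1 | rfl
        · exact PowerSeries.X_pow_dvd_iff.1 (ih k i j) m h1
        · exact h k i j
      -- At order zero the right hand side would have fibre degree -1, so it vanishes.
      rcases N with _ | n
      · intro k i j
        have h0 : PowerSeries.coeff 0 (u k i j) = 0 := by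
          ext m
          by_contra hm
          have := hug k i j 0 m hm
          push_cast at this
        simp only [hF, map_sub, PowerSeries.coeff_zero_X_mul, h0, sub_zero]
      · have hcl : ∀ k i j m, MvPolynomial.pderiv m (PowerSeries.coeff (n + 1) (u k i j))
            + MvPolynomial.pderiv i (PowerSeries.coeff (n + 1) (u k j m))
            + MvPolynomial.pderiv j (PowerSeries.coeff (n + 1) (u k m i)) = 0 := by
          -- The defect is t times `F`, so divisibility of `F` by t^{n+1} lets the Bianchi identity
          -- be used at order n + 2. Commuting partial derivatives remove the curl part of `F`,
          -- leaving closedness of `u`.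
          intro k i j m
          have hb := hpert.bianchi hs
            (x := fun i => PowerSeries.C (MvPolynomial.C (ξ i)))
            (p := fun i => PowerSeries.C (MvPolynomial.X i))
            (baseDer_C_C hξ) (baseDer_C_X D) fibreDer_C_X
            (N := n + 2) (fun k i j => by
              rw [hdef, pow_succ']
              exact mul_dvd_mul_left _ (ih k i j)) k m i j
          simp only [hdef, derivation_mul_left (hbt _), ← mul_add] at hb
          have hb1 := PowerSeries.X_pow_dvd_iff.1 hb (n + 2) (by omega)
          rw [PowerSeries.coeff_succ_X_mul] at hb1
          simp only [map_add, coeff_fibreDer, hF1, map_sub] at hb1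
          rw [pderiv_comm_apply m i, pderiv_comm_apply m j, pderiv_comm_apply i j] at hb1
          linear_combination -hb1
        intro k i j
        have hp := pderiv_radialStep (n := n) (husk k)
          (fun i j => (hug k i j).isHomogeneous (by push_cast; ring)) (hcl k) i j
        rw [hfix] at hp
        rw [hF1, hp, sub_self]
  rw [← sub_eq_zero]
  ext1 n
  exact PowerSeries.X_pow_dvd_iff.1 (key (n + 1) k i j) n n.lt_succ_self

end Solution

/-! ### Partial derivatives of smooth functions -/

section SmoothDerivations

variable {𝕜 : Type*} [RCLike 𝕜] {d : ℕ} {U : TopologicalSpace.Opens (Fin d → ℝ)}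

theorem zeroExt_add (f g : U → 𝕜) : zeroExt (f + g) = zeroExt f + zeroExt g := by
  funext x
  by_cases hx : x ∈ U
  · simp [zeroExt_apply _ hx]
  · have h : ∀ f : U → 𝕜, zeroExt f x = 0 := fun f =>
      Function.extend_apply' _ _ _ (by rintro ⟨y, rfl⟩; exact hx y.2)
    simp [h]

theorem zeroExt_mul (f g : U → 𝕜) : zeroExt (f * g) = zeroExt f * zeroExt g := by
  funext x
  by_cases hx : x ∈ U
  · simp [zeroExt_apply _ hx]
  · have h : ∀ f : U → 𝕜, zeroExt f x = 0 := fun f =>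
      Function.extend_apply' _ _ _ (by rintro ⟨y, rfl⟩; exact hx y.2)
    simp [h]

theorem differentiableAt_zeroExt (f : SmoothFun 𝕜 U) (x : U) :
    DifferentiableAt ℝ (zeroExt f.1) x.1 :=
  ((f.2 : ContDiffOn ℝ ∞ (zeroExt f.1) U).contDiffAt (U.isOpen.mem_nhds x.2)).differentiableAt
    (by simp)

/-- The partial derivative as a derivation of `C^∞(U)`. -/
def pdDer (i : Fin d) : IntDer (SmoothFun 𝕜 U) :=
  IntDer.mk (pd i)
    (fun f g => by
      ext x
      change fderiv ℝ (zeroExt (f.1 + g.1)) x.1 (Pi.single i 1) = _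
      rw [zeroExt_add, fderiv_add (differentiableAt_zeroExt f x) (differentiableAt_zeroExt g x)]
      rfl)
    (fun f g => by
      ext x
      change fderiv ℝ (zeroExt (f.1 * g.1)) x.1 (Pi.single i 1) = _
      rw [zeroExt_mul, fderiv_mul (differentiableAt_zeroExt f x) (differentiableAt_zeroExt g x),
        zeroExt_apply _ x.2, zeroExt_apply _ x.2]
      rfl)

variable (𝕜 U) in
/-- The coordinate function `x^i`. -/
def coordFun (i : Fin d) : SmoothFun 𝕜 U :=
  ⟨fun x => ((x.1 i : ℝ) : 𝕜), by
    have h : ContDiffOn ℝ ∞ (fun x : Fin d → ℝ => ((x i : ℝ) : 𝕜)) U :=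
      ((RCLike.ofRealCLM (K := 𝕜)).contDiff.comp (contDiff_apply ℝ ℝ i)).contDiffOn
    exact h.congr fun x hx => zeroExt_apply _ hx⟩

theorem pd_coordFun (l i : Fin d) : pd l (coordFun 𝕜 U i) = if i = l then 1 else 0 := by
  ext x
  have he : zeroExt (coordFun 𝕜 U i).1 =ᶠ[nhds x.1]
      (RCLike.ofRealCLM (K := 𝕜)).comp (ContinuousLinearMap.proj i) := by
    filter_upwards [U.isOpen.mem_nhds x.2] with y hy
    exact zeroExt_apply _ hy
  change fderiv ℝ (zeroExt (coordFun 𝕜 U i).1) x.1 (Pi.single l 1) = _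
  rw [he.fderiv_eq, ContinuousLinearMap.fderiv]
  by_cases h : i = l
  · subst h; simp
  · simp [h]

end SmoothDerivations

/-! ### Universal differential polynomials -/

section Universal

variable {R S : Type*} [CommRing R] [CommRing S] {d : ℕ} {σ : Type*}

theorem derivation_algebraMap_rat [Algebra ℚ R] (D : IntDer R) (q : ℚ) :
    D (algebraMap ℚ R q) = 0 := by
  rw [Algebra.algebraMap_eq_smul_one, map_rat_smul, Derivation.map_one_eq_zero, smul_zero]

/-- The formal partial derivative of differential polynomials. -/
def formalDer (i : Fin d) : IntDer (DiffPoly d σ) :=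
  IntDer.mk (MvPolynomial.mkDerivation ℚ fun v : List (Fin d) × σ =>
      (MvPolynomial.X (i :: v.1, v.2) : DiffPoly d σ)) (map_add _) (Derivation.leibniz _)

theorem formalDer_X (i : Fin d) (v : List (Fin d) × σ) :
    formalDer i (MvPolynomial.X v : DiffPoly d σ) = MvPolynomial.X (i :: v.1, v.2) :=
  MvPolynomial.mkDerivation_X ℚ _ v

variable {𝕜 : Type*} [RCLike 𝕜] {U : TopologicalSpace.Opens (Fin d → ℝ)}

/-- Evaluation of differential polynomials as a ring homomorphism. -/
def valueHom (a : σ → SmoothFun 𝕜 U) : DiffPoly d σ →+* SmoothFun 𝕜 U :=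
  (MvPolynomial.aeval fun v : List (Fin d) × σ => v.1.foldr pd (a v.2)).toRingHom

theorem valueHom_X (a : σ → SmoothFun 𝕜 U) (v : List (Fin d) × σ) :
    valueHom a (MvPolynomial.X v) = v.1.foldr pd (a v.2) :=
  MvPolynomial.aeval_X _ _

/-- Both sides are derivations along evaluation that kill rational constants. On generators they
agree because prepending i to the list of derivatives applies one further `pd i`. -/
theorem valueHom_formalDer (a : σ → SmoothFun 𝕜 U) (i : Fin d) (P : DiffPoly d σ) :
    valueHom a (formalDer i P) = (pdDer i : IntDer (SmoothFun 𝕜 U)) (valueHom a P) := by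
  induction P using MvPolynomial.induction_on with
  | C q =>
    have h1 : valueHom a (MvPolynomial.C q) = algebraMap ℚ (SmoothFun 𝕜 U) q :=
      MvPolynomial.aeval_C _ _
    rw [h1, derivation_algebraMap_rat, ← MvPolynomial.algebraMap_eq, derivation_algebraMap_rat,
      map_zero]
  | add P Q hP hQ => simp only [map_add, hP, hQ]
  | mul_X P v hP =>
    simp only [Derivation.leibniz, smul_eq_mul, map_add, map_mul, hP, formalDer_X, valueHom_X]
    rfl

/-- The series `Θ^{ij}` with coefficient functions `c`. -/
def thetaSeries (c : CoeffIndex d → R) (i j : Fin d) : PowerSeries (MvPolynomial (Fin d) R) :=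
  PowerSeries.mk fun n => symbolPoly fun k => c (.theta n i j k)

/-- The series `γ_i^j` with coefficient functions `c`. -/
def gammaSeries (c : CoeffIndex d → R) (i j : Fin d) : PowerSeries (MvPolynomial (Fin d) R) :=
  PowerSeries.mk fun n => symbolPoly fun k => c (.gamma n i j k)

theorem map_symbolPoly (φ : R →+* S) {n : ℕ} (c : (Fin n → Fin d) → R) :
    MvPolynomial.map φ (symbolPoly c) = symbolPoly fun k => φ (c k) := by
  simp [symbolPoly]

theorem formalMap_thetaSeries (φ : R →+* S) (c : CoeffIndex d → R) (i j : Fin d) :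
    formalMap φ (thetaSeries c i j) = thetaSeries (fun s => φ (c s)) i j := by
  ext1 n
  simp [thetaSeries, map_symbolPoly]

theorem formalMap_gammaSeries (φ : R →+* S) (c : CoeffIndex d → R) (i j : Fin d) :
    formalMap φ (gammaSeries c i j) = gammaSeries (fun s => φ (c s)) i j := by
  ext1 n
  simp [gammaSeries, map_symbolPoly]

theorem coeff_symbolPoly_ne_zero {n : ℕ} {c : (Fin n → Fin d) → R} {m : Fin d →₀ ℕ}
    (h : MvPolynomial.coeff m (symbolPoly c) ≠ 0) : m.degree = n := by
  rw [coeff_symbolPoly] at h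
  obtain ⟨k, hk, -⟩ := Finset.exists_ne_zero_of_sum_ne_zero h
  rw [← (Finset.mem_filter.1 hk).2, degree_exponent]

theorem pderiv_sum_C_mul_X (c : Fin d → R) (k : Fin d) :
    MvPolynomial.pderiv k (∑ l, MvPolynomial.C (c l) * MvPolynomial.X l)
      = MvPolynomial.C (c k) := by
  simp [Derivation.leibniz, MvPolynomial.pderiv_X, Pi.single_apply]

theorem thetaSeries_isGraded (c : CoeffIndex d → R) (i j : Fin d) :
    IsGraded 0 (thetaSeries c i j) := fun n m h => by
  rw [thetaSeries, PowerSeries.coeff_mk] at h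
  rw [coeff_symbolPoly_ne_zero h, add_zero]

theorem gammaSeries_isGraded (c : CoeffIndex d → R) (i j : Fin d) :
    IsGraded 1 (gammaSeries c i j) := fun n m h => by
  rw [gammaSeries, PowerSeries.coeff_mk] at h
  rw [coeff_symbolPoly_ne_zero h]
  push_cast
  rfl

variable [Algebra ℚ R] [Algebra ℚ S]

/-- The series `Λ^{ij}` with coefficient functions `c`. -/
def universalLambda (D : Fin d → IntDer R) (c : CoeffIndex d → R) :
    Fin d → Fin d → PowerSeries (MvPolynomial (Fin d) R) :=
  radialSolution D (thetaSeries c) (gammaSeries c)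

/-- The tensors `Υ` with coefficient functions `c`. -/
def universalUpsilon (D : Fin d → IntDer R) (c : CoeffIndex d → R) : UpsilonFamily d R :=
  -- Entry n has n + 1 symmetric indices and belongs to order t^{n+1} of Λ, hence to order t^{n+2}
  -- of the right hand side.
  fun n i j l => toTensor (n + 1) (PowerSeries.coeff (n + 2)
    (formalRHS D (thetaSeries c) (gammaSeries c) (universalLambda D c) i j l))

theorem map_universalUpsilon (φ : R →+* S) {D : Fin d → IntDer R} {D' : Fin d → IntDer S}
    (h : ∀ l r, φ (D l r) = D' l (φ r)) (c : CoeffIndex d → R) (n : ℕ) (i j l : Fin d)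
    (k : Fin (n + 1) → Fin d) :
    φ (universalUpsilon D c n i j l k) = universalUpsilon D' (fun s => φ (c s)) n i j l k := by
  rw [universalUpsilon, map_toTensor, ← PowerSeries.coeff_map, formalMap_formalRHS φ h,
    universalLambda, formalMap_radialSolution φ h]
  simp only [formalMap_thetaSeries, formalMap_gammaSeries]
  rfl

theorem value_universalUpsilon (S : CoeffIndex d → DiffPoly d σ) (a : σ → SmoothFun 𝕜 U) (n : ℕ)
    (i j l : Fin d) (k : Fin (n + 1) → Fin d) :
    (universalUpsilon formalDer S n i j l k).value a
      = universalUpsilon pdDer (fun s => (S s).value a) n i j l k :=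
  map_universalUpsilon (valueHom a) (valueHom_formalDer a) S n i j l k

end Universal

/-! ### The solution for a symplectic embedding -/

section Embedding

variable {𝕜 : Type*} [RCLike 𝕜] {d : ℕ} {U : TopologicalSpace.Opens (Fin d → ℝ)}

theorem bracket_eq_ham (Θ γ : Fin d → Fin d → FormalFun 𝕜 U) (F G : FormalFun 𝕜 U) :
    bracket Θ γ F G = ham (fun l => baseDer (pdDer l)) (fibreDer (SmoothFun 𝕜 U))
      (fun i j => PowerSeries.X * Θ i j)
      (fun m i => (if i = m then 1 else 0) + PowerSeries.X * γ m i) F G := by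
  have hb : ∀ l F, dBase l F = baseDer (R := SmoothFun 𝕜 U) (pdDer l) F := fun _ _ => rfl
  have hf : ∀ l F, dFibre l F = fibreDer (SmoothFun 𝕜 U) l F := fun _ _ => rfl
  simp only [bracket, hb, hf]
  rw [ham_apply_eq]

theorem lambdaSeries_succ (θ : Fin d → Fin d → SmoothFun 𝕜 U)
    (Υ : UpsilonFamily d (SmoothFun 𝕜 U)) (n : ℕ) (i j : Fin d) :
    PowerSeries.coeff (n + 1) (lambdaSeries θ Υ i j)
      = -((((n + 1 : ℕ) : ℚ) + 2)⁻¹ • ∑ l, MvPolynomial.X l * upsilonPoly Υ n i j l) := by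
  rw [lambdaSeries, PowerSeries.coeff_mk, ← Rat.cast_smul_eq_qsmul 𝕜]
  change -(((n : 𝕜) + 3)⁻¹ • _) = _
  have e : ((n : 𝕜) + 3)⁻¹ = (((((n + 1 : ℕ) : ℚ) + 2)⁻¹ : ℚ) : 𝕜) := by
    push_cast
    congr 1
    ring
  rw [e]

theorem jacobiator_cyclic (θ : Fin d → Fin d → SmoothFun 𝕜 U) (i j k : Fin d) :
    jacobiator θ j k i = jacobiator θ i j k := by
  simp only [jacobiator]
  congr 1
  exact Finset.sum_congr rfl fun l _ => by ring

namespace SymplecticEmbedding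

variable {θ : Fin d → Fin d → SmoothFun 𝕜 U} (E : SymplecticEmbedding U θ)

theorem multiplierEquation_iff (Λ : Fin d → Fin d → FormalFun 𝕜 U) :
    E.MultiplierEquation Λ ↔ ∀ k i j : Fin d,
      PowerSeries.X * (fibreDer (SmoothFun 𝕜 U) i (Λ k j) - fibreDer (SmoothFun 𝕜 U) j (Λ k i))
        = formalRHS pdDer (thetaSeries E.coeff) (gammaSeries E.coeff) Λ k i j := by
  have e : ∀ k i j, PowerSeries.X ^ 3 * ∑ l, (Λ l j * dBase l (Λ k i) - Λ l i * dBase l (Λ k j))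
      = PowerSeries.X ^ 3 * ∑ l, (Λ l j * baseDer (R := SmoothFun 𝕜 U) (pdDer l) (Λ k i)
        - Λ l i * baseDer (R := SmoothFun 𝕜 U) (pdDer l) (Λ k j)) := fun _ _ _ => rfl
  constructor
  · intro h k i j
    have h1 := h i j k
    rw [e] at h1
    rw [formalRHS, multiplierRHS]
    exact eq_sub_of_add_eq h1
  · intro h i j k
    have h1 := h k i j
    rw [formalRHS, multiplierRHS] at h1
    have h2 := add_eq_of_eq_sub h1
    rw [← e] at h2
    exact h2

theorem coeff_one_theta (i j : Fin d) :
    PowerSeries.coeff 1 (thetaSeries E.coeff i j)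
      = -∑ k, MvPolynomial.C (jacobiator θ i j k) * MvPolynomial.X k := by
  rw [thetaSeries, PowerSeries.coeff_mk, symbolPoly, ← Finset.sum_neg_distrib]
  refine Fintype.sum_equiv (Equiv.funUnique (Fin 1) (Fin d)) _ _ fun k => ?_
  simp [E.theta_one]

theorem coeff_one_formalRHS_embedding (Λ : Fin d → Fin d → FormalFun 𝕜 U) (k i j : Fin d) :
    PowerSeries.coeff 1 (formalRHS pdDer (thetaSeries E.coeff) (gammaSeries E.coeff) Λ k i j)
      = MvPolynomial.C (jacobiator θ i j k) := by
  rw [coeff_one_formalRHS, coeff_one_theta, map_neg, neg_neg]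
  exact pderiv_sum_C_mul_X _ k

/-- The order-t right hand side is the Jacobiator whatever Λ is, and its radial potential is the
prescribed leading term; cyclicity of Π puts the indices in order. -/
theorem coeff_zero_lambdaSeries (Υ : UpsilonFamily d (SmoothFun 𝕜 U))
    (Λ : Fin d → Fin d → FormalFun 𝕜 U) (i j : Fin d) :
    PowerSeries.coeff 0 (lambdaSeries θ Υ i j) = PowerSeries.coeff 0
      (radialStep pdDer (thetaSeries E.coeff) (gammaSeries E.coeff) Λ i j) := by
  rw [radialStep, PowerSeries.coeff_mk, lambdaSeries, PowerSeries.coeff_mk,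
    ← Rat.cast_smul_eq_qsmul 𝕜]
  simp only [zero_add, coeff_one_formalRHS_embedding, jacobiator_cyclic]
  change -((2 : 𝕜)⁻¹ • _) = _
  have e : (((((0 : ℕ) : ℚ) + 2)⁻¹ : ℚ) : 𝕜) = (2 : 𝕜)⁻¹ := by
    push_cast
    rw [zero_add]
  rw [e]
  have e' : ∀ k, (MvPolynomial.C (jacobiator θ i j k) * MvPolynomial.X k : FibrePoly 𝕜 U)
      = MvPolynomial.X k * MvPolynomial.C (jacobiator θ i j k) := fun k => mul_comm _ _
  simp only [e']

theorem radialStep_lambdaSeries {Υ : UpsilonFamily d (SmoothFun 𝕜 U)}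
    (h : ∀ n i j l, upsilonPoly Υ n i j l = PowerSeries.coeff (n + 2)
      (formalRHS pdDer (thetaSeries E.coeff) (gammaSeries E.coeff) (lambdaSeries θ Υ) i j l)) :
    radialStep pdDer (thetaSeries E.coeff) (gammaSeries E.coeff) (lambdaSeries θ Υ)
      = lambdaSeries θ Υ := by
  funext i j
  ext1 n
  rcases n with _ | n
  · exact (E.coeff_zero_lambdaSeries _ _ i j).symm
  · rw [lambdaSeries_succ, radialStep, PowerSeries.coeff_mk]
    simp only [h]

theorem universalLambda_isGraded (i j : Fin d) :
    IsGraded 1 (universalLambda pdDer E.coeff i j) :=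
  radialSolution_isGraded (thetaSeries_isGraded E.coeff) (gammaSeries_isGraded E.coeff) i j

theorem upsilonPoly_universal (n : ℕ) (i j l : Fin d) :
    upsilonPoly (universalUpsilon pdDer E.coeff) n i j l = PowerSeries.coeff (n + 2)
      (formalRHS pdDer (thetaSeries E.coeff) (gammaSeries E.coeff)
        (universalLambda pdDer E.coeff) i j l) :=
  symbolPoly_toTensor ((IsGraded.multiplierRHS pdDer (thetaSeries_isGraded E.coeff)
    (gammaSeries_isGraded E.coeff) E.universalLambda_isGraded i j l).isHomogeneous
      (by push_cast; ring))

theorem lambdaSeries_universal :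
    lambdaSeries θ (universalUpsilon pdDer E.coeff) = universalLambda pdDer E.coeff := by
  funext i j
  ext1 n
  conv_rhs => rw [universalLambda, ← radialStep_radialSolution]
  rcases n with _ | n
  · exact E.coeff_zero_lambdaSeries _ _ i j
  · rw [lambdaSeries_succ, radialStep, PowerSeries.coeff_mk]
    simp only [upsilonPoly_universal]
    rfl

theorem thetaSeries_skew (i j : Fin d) :
    thetaSeries E.coeff j i = -thetaSeries E.coeff i j := by
  ext1 n
  simp [thetaSeries, symbolPoly, E.theta_skew _ i j]

theorem structureEquations : StructureEquations (fun l => baseDer (pdDer l))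
    (fibreDer (SmoothFun 𝕜 U)) (fun i j => PowerSeries.X * thetaSeries E.coeff i j)
    (fun m i => (if i = m then 1 else 0) + PowerSeries.X * gammaSeries E.coeff m i) := by
  refine structureEquations_of_jacobi (x := fun i => PowerSeries.C (MvPolynomial.C (coordFun 𝕜 U i)))
    (p := fun i => PowerSeries.C (MvPolynomial.X i)) (fun i j => ?_) (fun f g h => ?_)
    (baseDer_C_C pd_coordFun) (fun l i => ?_) (baseDer_C_X _) fibreDer_C_X
  · rw [E.thetaSeries_skew i j, mul_neg]
  · have := E.jacobi f g h
    simp only [bracket_eq_ham] at this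
    exact this
  · rw [fibreDer_C, MvPolynomial.pderiv_C, map_zero]

theorem multiplierEquation_universal (k i j : Fin d) :
    PowerSeries.X * (fibreDer (SmoothFun 𝕜 U) i (universalLambda pdDer E.coeff k j)
        - fibreDer (SmoothFun 𝕜 U) j (universalLambda pdDer E.coeff k i))
      = formalRHS pdDer (thetaSeries E.coeff) (gammaSeries E.coeff)
        (universalLambda pdDer E.coeff) k i j :=
  radialSolution_spec (thetaSeries_isGraded E.coeff) (gammaSeries_isGraded E.coeff)
    E.thetaSeries_skew pd_coordFun E.structureEquations radialStep_radialSolution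
    E.universalLambda_isGraded k i j

theorem pderiv_lambda_universal (n : ℕ) (k i j : Fin d) :
    MvPolynomial.pderiv i (PowerSeries.coeff n (universalLambda pdDer E.coeff k j))
        - MvPolynomial.pderiv j (PowerSeries.coeff n (universalLambda pdDer E.coeff k i))
      = PowerSeries.coeff (n + 1) (formalRHS pdDer (thetaSeries E.coeff) (gammaSeries E.coeff)
        (universalLambda pdDer E.coeff) k i j) := by
  rw [← E.multiplierEquation_universal, PowerSeries.coeff_succ_X_mul, map_sub, coeff_fibreDer,
    coeff_fibreDer]

theorem isUpsilon_universal : IsUpsilon E (universalUpsilon pdDer E.coeff) where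
  symm n i j l := toTensor_isSymm _ _
  skew n i j l k := by
    rw [universalUpsilon, universalUpsilon, formalRHS, multiplierRHS_skew E.thetaSeries_skew,
      map_neg, toTensor_neg]
  integrable n i j l m := by
    -- Once (*) is known, Υ is a curl, and the integrability condition is just symmetry of second
    -- derivatives.
    simp only [upsilonPoly_universal, ← pderiv_lambda_universal, map_sub]
    rw [pderiv_comm_apply m j, pderiv_comm_apply m l, pderiv_comm_apply j l]
    ring
  equation := by
    rw [lambdaSeries_universal, multiplierEquation_iff]
    exact E.multiplierEquation_universal

variable {E} in
-- By integrability Υ is the curl of its own Λ, and (*) equates this curl with the right hand side.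
-- Thus Λ is a fixed point of the radial step, hence the universal one, and the symmetric tensors
-- are recovered from their polynomials.
theorem _root_.AlmostPoisson.IsUpsilon.eq_universal {Υ : UpsilonFamily d (SmoothFun 𝕜 U)}
    (h : IsUpsilon E Υ) : Υ = universalUpsilon pdDer E.coeff := by
  have hpot : ∀ n k i j, upsilonPoly Υ n k i j
      = MvPolynomial.pderiv i (PowerSeries.coeff (n + 1) (lambdaSeries θ Υ k j))
        - MvPolynomial.pderiv j (PowerSeries.coeff (n + 1) (lambdaSeries θ Υ k i)) := by
    intro n k i j
    have h1 := homotopy_formula_smul (u := fun j l => upsilonPoly Υ n k j l) (n := n + 1)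
      (fun j l => ?_) (fun j l => ?_) (fun j l m => h.integrable n k j l m) i j
    · rw [lambdaSeries_succ, lambdaSeries_succ, h1]
    · rw [upsilonPoly, upsilonPoly, show Υ n k l j = fun s => -Υ n k j l s from
        funext (h.skew n k j l)]
      exact symbolPoly_neg _
    · intro m hm
      have := coeff_symbolPoly_ne_zero (c := Υ n k j l) hm
      rwa [Finsupp.degree_eq_weight_one] at this
  have hE := (E.multiplierEquation_iff _).1 h.equation
  have hu : ∀ n k i j, upsilonPoly Υ n k i j = PowerSeries.coeff (n + 2)
      (formalRHS pdDer (thetaSeries E.coeff) (gammaSeries E.coeff) (lambdaSeries θ Υ) k i j) := by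
    intro n k i j
    rw [← hE, PowerSeries.coeff_succ_X_mul, map_sub, coeff_fibreDer, coeff_fibreDer, hpot]
  have hΛ : lambdaSeries θ Υ = universalLambda pdDer E.coeff :=
    radialStep_fixed_unique (E.radialStep_lambdaSeries hu) radialStep_radialSolution
  funext n i j l
  rw [universalUpsilon, ← hΛ, ← hu]
  exact (toTensor_symbolPoly (h.symm n i j l)).symm

end SymplecticEmbedding

end Embedding

end AlmostPoisson

end

theorem corollary4p6 (𝕜 : Type*) [RCLike 𝕜] (d : ℕ) :
    ∃ P : AlmostPoisson.UpsilonFamily d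
        (AlmostPoisson.DiffPoly d (AlmostPoisson.CoeffIndex d)),
      (∀ (U : TopologicalSpace.Opens (Fin d → ℝ))
          (θ : Fin d → Fin d → AlmostPoisson.SmoothFun 𝕜 U)
          (_hθ : ∀ i j, θ j i = -θ i j)
          (E : AlmostPoisson.SymplecticEmbedding U θ),
        let Υ : AlmostPoisson.UpsilonFamily d (AlmostPoisson.SmoothFun 𝕜 U) :=
          fun n i j l k => (P n i j l k).value E.coeff
        let Λ := AlmostPoisson.lambdaSeries θ Υ
        AlmostPoisson.IsUpsilon E Υ ∧
        (∀ n i j k,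
          MvPolynomial.pderiv i (PowerSeries.coeff (n + 1) (Λ k j))
              - MvPolynomial.pderiv j (PowerSeries.coeff (n + 1) (Λ k i))
            = AlmostPoisson.upsilonPoly Υ n k i j) ∧
        (∀ Υ', AlmostPoisson.IsUpsilon E Υ' → Υ' = Υ)) ∧
      (∀ S : AlmostPoisson.CoeffIndex d → AlmostPoisson.DiffPoly d (Fin d × Fin d),
        ∃ Q : AlmostPoisson.UpsilonFamily d (AlmostPoisson.DiffPoly d (Fin d × Fin d)),
          ∀ (U : TopologicalSpace.Opens (Fin d → ℝ))
            (θ : Fin d → Fin d → AlmostPoisson.SmoothFun 𝕜 U)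
            (_hθ : ∀ i j, θ j i = -θ i j)
            (E : AlmostPoisson.SymplecticEmbedding U θ),
            (∀ s, E.coeff s = (S s).value fun ij => θ ij.1 ij.2) →
            ∀ n i j l k,
              (P n i j l k).value E.coeff = (Q n i j l k).value fun ij => θ ij.1 ij.2) := by
  -- The universal polynomials come from the same construction over differential polynomials, the
  -- coefficient functions being the underived variables; for embeddings built from θ they are
  -- replaced by the polynomials `S`.
  refine ⟨AlmostPoisson.universalUpsilon AlmostPoisson.formalDer fun s => MvPolynomial.X ([], s),
    fun U θ _ E => ?_, fun S => ⟨AlmostPoisson.universalUpsilon AlmostPoisson.formalDer S,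
      fun U θ _ E hE n i j l k => ?_⟩⟩
  · have hv : (fun n i j l k => (AlmostPoisson.universalUpsilon AlmostPoisson.formalDer
        (fun s => MvPolynomial.X ([], s)) n i j l k).value E.coeff)
        = AlmostPoisson.universalUpsilon AlmostPoisson.pdDer E.coeff := by
      funext n i j l k
      rw [AlmostPoisson.value_universalUpsilon]
      congr 1
      funext s
      exact AlmostPoisson.valueHom_X E.coeff ([], s)
    dsimp only
    rw [hv]
    refine ⟨E.isUpsilon_universal, fun n i j k => ?_, fun Υ' h => h.eq_universal⟩
    rw [E.lambdaSeries_universal, E.pderiv_lambda_universal, E.upsilonPoly_universal]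
  · rw [AlmostPoisson.value_universalUpsilon, AlmostPoisson.value_universalUpsilon]
    congr 1
    funext s
    exact (AlmostPoisson.valueHom_X E.coeff ([], s)).trans (hE s)
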